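/- Let $(M,g)$ be a smooth $n$-dimensional Riemannian manifold and $\pi:T^*M\to M$ its cotangent bundle. Let $(U,x^1,\dots,x^n)$ be a local chart of $M$ and $(\pi^{-1}(U),q^1,\dots,q^n,p_1,\dots,p_n)$ the induced chart of $T^*M$, so $q^i=x^i\circ\pi$ and $p=p_i\,dx^i$. Summation over repeated indices from $1$ to $n$ is understood. Let $g_{ij}$ be the components of $g$, $(g^{ij})$ the inverse matrix of $(g_{ij})$, $\Gamma^k_{ij}$ the Christoffel symbols of $g$, and $R^h_{kij}$ the components of the curvature tensor of the Levi-Civita connection $\dot\nabla$ of $g$, with $R(\partial_i,\partial_j)\partial_k=R^h_{kij}\partial_h$ and $R(X,Y)=[\dot\nabla_X,\dot\nabla_Y]-\dot\nabla_{[X,Y]}$. Put $g^{0i}=p_hg^{hi}$, $t=\tfrac12 g^{ik}p_ip_k\ge 0$ and $$\frac{\delta}{\delta q^i}=\frac{\partial}{\partial q^i}+p_k\Gamma^k_{ih}\frac{\partial}{\partial p_h}.$$ Let $A>0$ be a constant and let $\lambda,b_1:[0,\infty)\to\mathbb R$ be smooth functions with $\lambda(t)>0$ and $A+2t\lambda(t)b_1(t)>0$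 for all $t\ge 0$. Let $J$ be the natural almost complex structure of diagonal type on $T^*M$ with these parameters, that is, the tensor field given in the adapted frame by $$J\frac{\delta}{\delta q^i}=J^{(1)}_{ij}\frac{\partial}{\partial p_j},\qquad J\frac{\partial}{\partial p_i}=-J_{(2)}^{ij}\frac{\delta}{\delta q^j},$$ $$J^{(1)}_{ij}=\frac{A}{\lambda}g_{ij}+b_1p_ip_j,\qquad J_{(2)}^{ij}=\frac{\lambda}{A}g^{ij}-\frac{\lambda^2b_1}{A(A+2t\lambda b_1)}g^{0i}g^{0j},$$ where $\lambda,b_1$ are evaluated at $t$. Then the Nijenhuis tensor field $N(X,Y)=[JX,JY]-J[JX,Y]-J[X,JY]-[X,Y]$ is given on $\pi^{-1}(U)$, for all $i,j\in\{1,\dots,n\}$, by $$N\Big(\frac{\delta}{\delta q^i},\frac{\delta}{\delta q^j}\Big)=-\Big\{\frac{A}{\lambda^3}\big[b_1\lambda(\lambda+2t\lambda')+A\lambda'\big](\delta_i^hg_{jk}-\delta_j^hg_{ik})+R^h_{kij}\Big\}p_h\frac{\partial}{\partial p_k},$$ $$N\Big(\frac{\delta}{\delta q^i},\frac{\partial}{\partial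 p_j}\Big)=-J_{(2)}^{kl}J_{(2)}^{jr}\Big\{\frac{A}{\lambda^3}\big[b_1\lambda(\lambda+2t\lambda')+A\lambda'\big](\delta_i^hg_{rl}-\delta_r^hg_{il})+R^h_{lir}\Big\}p_h\frac{\delta}{\delta q^k},$$ $$N\Big(\frac{\partial}{\partial p_i},\frac{\partial}{\partial p_j}\Big)=-J_{(2)}^{ir}J_{(2)}^{jl}\Big\{\frac{A}{\lambda^3}\big[b_1\lambda(\lambda+2t\lambda')+A\lambda'\big](\delta_l^hg_{rk}-\delta_r^hg_{lk})+R^h_{klr}\Big\}p_h\frac{\partial}{\partial p_k}.$$ -/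

import Mathlib

open scoped Manifold ContDiff Bundle
open Set Bundle VectorField

noncomputable section

namespace CotangentGeometry

/-- The model space `ℝⁿ`. -/
abbrev Rn (n : ℕ) : Type := EuclideanSpace ℝ (Fin n)

/-- The `i`-th standard basis vector of `ℝⁿ`. -/
def stdVec {n : ℕ} (i : Fin n) : Rn n := EuclideanSpace.single i 1

/-- The partial derivative `∂f/∂xⁱ` of a function on (an open subset of) `ℝⁿ`. -/
def pd {n : ℕ} (i : Fin n) (f : Rn n → ℝ) (x : Rn n) : ℝ := fderiv ℝ f x (stdVec i)

section Nijenhuis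

variable {E : Type*} [NormedAddCommGroup E] [NormedSpace ℝ E]
  {H : Type*} [TopologicalSpace H] (I : ModelWithCorners ℝ E H)
  {N : Type*} [TopologicalSpace N] [ChartedSpace H N]

/-- The Nijenhuis expression
`N(X, Y) = [JX, JY] - J[JX, Y] - J[X, JY] - [X, Y]`
of a field `J` of endomorphisms of the tangent spaces, on the vector fields `X`, `Y`. -/
def nijenhuis (J : ∀ x : N, TangentSpace I x →L[ℝ] TangentSpace I x)
    (X Y : ∀ x : N, TangentSpace I x) (x : N) : TangentSpace I x :=
  mlieBracket I (fun y => J y (X y)) (fun y => J y (Y y)) x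
    - J x (mlieBracket I (fun y => J y (X y)) Y x)
    - J x (mlieBracket I X (fun y => J y (Y y)) x)
    - mlieBracket I X Y x

end Nijenhuis

section Cotangent

variable {n : ℕ} {M : Type*} [TopologicalSpace M] [ChartedSpace (Rn n) M]
  [IsManifold 𝓘(ℝ, Rn n) ∞ M]

variable (n M) in
/-- The cotangent bundle `T*M` of an `n`-dimensional smooth manifold, as a bundle of continuous
linear forms on the tangent spaces (with Mathlib's manifold structure on its total space). -/
abbrev CotangentBundle : Type _ :=
  TotalSpace (Rn n →L[ℝ] ℝ) (fun x : M => TangentSpace 𝓘(ℝ, Rn n) x →L[ℝ] Bundle.Trivial M ℝ x)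

variable (n) in
/-- The model with corners of `T*M`. -/
abbrev cotModel : ModelWithCorners ℝ (Rn n × (Rn n →L[ℝ] ℝ)) (ModelProd (Rn n) (Rn n →L[ℝ] ℝ)) :=
  (𝓘(ℝ, Rn n)).prod 𝓘(ℝ, Rn n →L[ℝ] ℝ)

variable (n M) in
/-- Smooth Riemannian metrics on `M`. -/
abbrev Metric : Type _ :=
  ContMDiffRiemannianMetric 𝓘(ℝ, Rn n) ∞ (Rn n) (fun x : M => TangentSpace 𝓘(ℝ, Rn n) x)

/-! ### Coordinate expressions on the base, in a chart `e = (x¹, …, xⁿ)` of `M` -/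

/-- The coordinate vector field `∂/∂xⁱ` of the chart `e`, at points of `e.source`. -/
def coordField (e : OpenPartialHomeomorph M (Rn n)) (i : Fin n) (x : M) :
    TangentSpace 𝓘(ℝ, Rn n) x :=
  mpullback 𝓘(ℝ, Rn n) 𝓘(ℝ, Rn n) e (fun _ => stdVec i) x

/-- The matrix `(g_ij)` of the metric in the chart `e`, as a function of the coordinates. -/
def gDown (g : Metric n M) (e : OpenPartialHomeomorph M (Rn n)) (q : Rn n) :
    Matrix (Fin n) (Fin n) ℝ :=
  Matrix.of fun i j => g.inner (e.symm q) (coordField e i (e.symm q)) (coordField e j (e.symm q))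

/-- The inverse matrix `(g^ij)`. -/
def gUp (g : Metric n M) (e : OpenPartialHomeomorph M (Rn n)) (q : Rn n) :
    Matrix (Fin n) (Fin n) ℝ :=
  (gDown g e q)⁻¹

/-- The Christoffel symbols `Γ^k_ij` of the Levi-Civita connection of `g` in the chart `e`. -/
def christoffel (g : Metric n M) (e : OpenPartialHomeomorph M (Rn n)) (k i j : Fin n)
    (q : Rn n) : ℝ :=
  (1 / 2) * ∑ l, gUp g e q k l *
    (pd i (fun y => gDown g e y j l) q + pd j (fun y => gDown g e y i l) q
      - pd l (fun y => gDown g e y i j) q)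

/-- The curvature components `R^h_kij`, defined by `R(∂_i, ∂_j) ∂_k = R^h_kij ∂_h` with
`R(X, Y) = [∇_X, ∇_Y] - ∇_[X, Y]`. -/
def curvature (g : Metric n M) (e : OpenPartialHomeomorph M (Rn n)) (h k i j : Fin n)
    (q : Rn n) : ℝ :=
  pd i (christoffel g e h j k) q - pd j (christoffel g e h i k) q
    + ∑ l, (christoffel g e h i l q * christoffel g e l j k q
      - christoffel g e h j l q * christoffel g e l i k q)

/-! ### The induced chart of `T*M` and the adapted frame -/

/-- The induced coordinates `(q¹, …, qⁿ, p₁, …, pₙ)` on `π⁻¹(e.source) ⊆ T*M`. -/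
def inducedChart (e : OpenPartialHomeomorph M (Rn n)) (ξ : CotangentBundle n M) : Rn n × Rn n :=
  (e ξ.proj, WithLp.toLp 2 fun i => ξ.snd (coordField e i ξ.proj))

/-- The base coordinates `q` of a covector. -/
def qCoord (e : OpenPartialHomeomorph M (Rn n)) (ξ : CotangentBundle n M) : Rn n :=
  (inducedChart e ξ).1

/-- The fibre coordinates `p_i` of a covector. -/
def pCoord (e : OpenPartialHomeomorph M (Rn n)) (i : Fin n) (ξ : CotangentBundle n M) : ℝ :=
  (inducedChart e ξ).2 i

/-- The coordinate vector field `∂/∂qⁱ` on `π⁻¹(e.source)`. -/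
def dq (e : OpenPartialHomeomorph M (Rn n)) (i : Fin n) (ξ : CotangentBundle n M) :
    TangentSpace (cotModel n) ξ :=
  mpullback (cotModel n) 𝓘(ℝ, Rn n × Rn n) (inducedChart e) (fun _ => (stdVec i, (0 : Rn n))) ξ

/-- The coordinate vector field `∂/∂p_i` on `π⁻¹(e.source)`. -/
def dp (e : OpenPartialHomeomorph M (Rn n)) (i : Fin n) (ξ : CotangentBundle n M) :
    TangentSpace (cotModel n) ξ :=
  mpullback (cotModel n) 𝓘(ℝ, Rn n × Rn n) (inducedChart e) (fun _ => ((0 : Rn n), stdVec i)) ξ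

/-- The horizontal field `δ/δqⁱ = ∂/∂qⁱ + p_k Γ^k_ih ∂/∂p_h` on `π⁻¹(e.source)`. -/
def deltaq (g : Metric n M) (e : OpenPartialHomeomorph M (Rn n)) (i : Fin n)
    (ξ : CotangentBundle n M) : TangentSpace (cotModel n) ξ :=
  dq e i ξ + ∑ h, (∑ k, pCoord e k ξ * christoffel g e k i h (qCoord e ξ)) • dp e h ξ

/-- The raised fibre coordinates `g^{0i} = p_h g^{hi}`. -/
def pUp (g : Metric n M) (e : OpenPartialHomeomorph M (Rn n)) (i : Fin n)
    (ξ : CotangentBundle n M) : ℝ :=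
  ∑ h, pCoord e h ξ * gUp g e (qCoord e ξ) h i

/-- The energy density `t = ½ g^{ik} p_i p_k`. -/
def energy (g : Metric n M) (e : OpenPartialHomeomorph M (Rn n)) (ξ : CotangentBundle n M) : ℝ :=
  (1 / 2) * ∑ i, ∑ k, gUp g e (qCoord e ξ) i k * pCoord e i ξ * pCoord e k ξ

/-! ### The natural almost complex structures of diagonal type -/

/-- The coefficient `b₂ = -λ² b₁ / (A (A + 2 t λ b₁))`. -/
def b₂ (A : ℝ) (lam b₁ : ℝ → ℝ) (t : ℝ) : ℝ :=
  -(lam t ^ 2 * b₁ t) / (A * (A + 2 * t * lam t * b₁ t))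

/-- `J^{(1)}_ij = a₁(t) g_ij + b₁(t) p_i p_j` with `a₁ = A / λ`. -/
def J₁ (g : Metric n M) (A : ℝ) (lam b₁ : ℝ → ℝ) (e : OpenPartialHomeomorph M (Rn n))
    (i j : Fin n) (ξ : CotangentBundle n M) : ℝ :=
  A / lam (energy g e ξ) * gDown g e (qCoord e ξ) i j
    + b₁ (energy g e ξ) * pCoord e i ξ * pCoord e j ξ

/-- `J_{(2)}^ij = a₂(t) g^ij + b₂(t) g^{0i} g^{0j}` with `a₂ = λ / A`. -/
def J₂ (g : Metric n M) (A : ℝ) (lam b₁ : ℝ → ℝ) (e : OpenPartialHomeomorph M (Rn n))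
    (i j : Fin n) (ξ : CotangentBundle n M) : ℝ :=
  lam (energy g e ξ) / A * gUp g e (qCoord e ξ) i j
    + b₂ A lam b₁ (energy g e ξ) * pUp g e i ξ * pUp g e j ξ

/-- `J` is, over the domain of the chart `e`, the natural tensor field of diagonal type with
parameters `A`, `λ`, `b₁`: it is the field of endomorphisms given in the adapted frame by
`J δ/δqⁱ = J^{(1)}_ij ∂/∂p_j` and `J ∂/∂p_i = -J_{(2)}^ij δ/δq^j`. -/
def IsNaturalDiagonalOn (g : Metric n M) (A : ℝ) (lam b₁ : ℝ → ℝ)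
    (e : OpenPartialHomeomorph M (Rn n))
    (J : ∀ ξ : CotangentBundle n M, TangentSpace (cotModel n) ξ →L[ℝ] TangentSpace (cotModel n) ξ) :
    Prop :=
  ∀ ξ : CotangentBundle n M, ξ.proj ∈ e.source → ∀ i : Fin n,
    J ξ (deltaq g e i ξ) = ∑ j, J₁ g A lam b₁ e i j ξ • dp e j ξ ∧
    J ξ (dp e i ξ) = -∑ j, J₂ g A lam b₁ e i j ξ • deltaq g e j ξ

/-- The derivative `λ'` of a function on `[0, ∞)` (one-sided at `0`). -/
def derivHalfLine (f : ℝ → ℝ) (t : ℝ) : ℝ := derivWithin f (Ici 0) t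

/-- The components
`(A/λ³) [b₁ λ (λ + 2 t λ') + A λ'] (δ^h_i g_jk - δ^h_j g_ik) + R^h_kij`, taken at `t`. -/
def W (g : Metric n M) (A : ℝ) (lam b₁ : ℝ → ℝ) (e : OpenPartialHomeomorph M (Rn n))
    (h k i j : Fin n) (ξ : CotangentBundle n M) : ℝ :=
  let t := energy g e ξ
  let q := qCoord e ξ
  A / lam t ^ 3 *
      (b₁ t * lam t * (lam t + 2 * t * derivHalfLine lam t) + A * derivHalfLine lam t) *
      ((if h = i then 1 else 0) * gDown g e q j k - (if h = j then 1 else 0) * gDown g e q i k)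
    + curvature g e h k i j q

end Cotangent

end CotangentGeometry

end

open CotangentGeometry

noncomputable section

/-! Only the first formula needs a differential computation; the other two follow algebraically. The
matrices of `J₁` and `J₂` are mutually inverse, so `J² = -1` over the chart. Hence `N(X, JY) = -J
N(X, Y)` (`nijenhuis_apply_right`), and `N` is linear over functions in its second argument
(`nijenhuis_sum_smul_right`). Since `∂/∂p_j = J₂^{jr} J δ/δq^r`, each vertical argument is replaced
by horizontal ones at the cost of `J₂` and `-J`. One replacement gives the second formula; two
replacements, with antisymmetry in between, give the third, where the two factors `-J` cancel the
sign.

For the first formula, write `δ_i` for `δ/δq^i`. The fields `δ_i` and `Jδ_i` have constant base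
components in the induced chart, so all their brackets are vertical, and three computations remain.
(a) The metric is parallel, so `δ_i t = 0` and `[δ_i, Jδ_j]` has components `Γ^l_ij J₁_lk`. This is
symmetric in `i, j`, so the two mixed terms of `N` cancel. (b) `[δ_i, δ_j]` has components `p_h
R^h_kij` (`sum_curvature_mul`). (c) `Jδ_i` differentiates `t` to `(A/λ + 2t b₁) p_i`. In `[Jδ_i,
Jδ_j]` the `b₁'` terms are symmetric and drop out; what is left is `-(A/λ³)[b₁λ(λ + 2tλ') + Aλ'](p_i
g_jk - p_j g_ik)`. -/

namespace CotangentGeometry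

/-! ### Algebraic properties of the Nijenhuis expression. -/

section NijenhuisTensorial

variable {E : Type*} [NormedAddCommGroup E] [NormedSpace ℝ E]
  {H : Type*} [TopologicalSpace H] {I : ModelWithCorners ℝ E H}
  {N : Type*} [TopologicalSpace N] [ChartedSpace H N]

theorem nijenhuis_swap (J : ∀ x : N, TangentSpace I x →L[ℝ] TangentSpace I x)
    (X Y : ∀ x : N, TangentSpace I x) (x : N) :
    nijenhuis I J X Y x = -nijenhuis I J Y X x := by
  unfold nijenhuis
  rw [mlieBracket_swap_apply (V := fun y => J y (X y)) (W := fun y => J y (Y y)),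
    mlieBracket_swap_apply (V := fun y => J y (X y)) (W := Y),
    mlieBracket_swap_apply (V := X) (W := fun y => J y (Y y)),
    mlieBracket_swap_apply (V := X) (W := Y), map_neg, map_neg]
  abel

theorem nijenhuis_congr_right (J : ∀ x : N, TangentSpace I x →L[ℝ] TangentSpace I x)
    (X : ∀ x : N, TangentSpace I x) {Y Y' : ∀ x : N, TangentSpace I x} {x : N}
    (h : Y =ᶠ[nhds x] Y') :
    nijenhuis I J X Y x = nijenhuis I J X Y' x := by
  have hJ : (fun y => J y (Y y)) =ᶠ[nhds x] fun y => J y (Y' y) :=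
    h.mono fun y hy => congrArg (J y) hy
  have r (Z : ∀ x : N, TangentSpace I x) : Z =ᶠ[nhds x] Z := Filter.EventuallyEq.rfl
  unfold nijenhuis
  rw [(r _).mlieBracket_vectorField_eq hJ, (r _).mlieBracket_vectorField_eq h,
    (r _).mlieBracket_vectorField_eq hJ, (r _).mlieBracket_vectorField_eq h]

variable [IsManifold I 2 N] [CompleteSpace E]

/-- If `J² Y = -Y` near `x`, then `N(X, JY) = -J N(X, Y)`. -/
theorem nijenhuis_apply_right (J : ∀ x : N, TangentSpace I x →L[ℝ] TangentSpace I x)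
    (X Y : ∀ x : N, TangentSpace I x) {x : N}
    (hYd : MDifferentiableAt I I.tangent (fun y => (Y y : TangentBundle I N)) x)
    (hY : ∀ᶠ y in nhds x, J y (J y (Y y)) = -Y y)
    (hJ : ∀ v : TangentSpace I x, J x (J x v) = -v) :
    nijenhuis I J X (fun y => J y (Y y)) x = -J x (nijenhuis I J X Y x) := by
  have hY' : (fun y => J y (J y (Y y))) =ᶠ[nhds x] -Y := hY
  have r (Z : ∀ x : N, TangentSpace I x) : Z =ᶠ[nhds x] Z := Filter.EventuallyEq.rfl
  have neg_right (V : ∀ x : N, TangentSpace I x) :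
      mlieBracket I V (-Y) x = -mlieBracket I V Y x := by
    have h := mlieBracket_const_smul_right (c := (-1 : ℝ)) (V := V) hYd
    have e : (-1 : ℝ) • Y = -Y := by ext; simp
    rwa [e, neg_one_smul] at h
  unfold nijenhuis
  rw [(r _).mlieBracket_vectorField_eq hY', (r _).mlieBracket_vectorField_eq hY',
    neg_right, neg_right]
  simp only [map_sub, map_neg, hJ]
  abel

theorem mlieBracket_sum_smul_right {ι : Type*} (s : Finset ι)
    (V : ∀ x : N, TangentSpace I x) {f : ι → N → ℝ} {W : ι → ∀ x : N, TangentSpace I x} {x : N}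
    (hf : ∀ i ∈ s, MDifferentiableAt I 𝓘(ℝ, ℝ) (f i) x)
    (hW : ∀ i ∈ s, MDifferentiableAt I I.tangent (fun y => (W i y : TangentBundle I N)) x) :
    mlieBracket I V (fun y => ∑ i ∈ s, f i y • W i y) x
      = ∑ i ∈ s, (mvfderiv I (f i) x (V x) • W i x + f i x • mlieBracket I V (W i) x) := by
  classical
  induction s using Finset.induction_on with
  | empty => 
    simp only [Finset.sum_empty]
    exact congrFun (mlieBracket_zero_right (I := I) (W := V)) x
  | insert a s ha ih =>
    simp only [Finset.sum_insert ha]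
    have h1 := hf a (Finset.mem_insert_self _ _)
    have h2 := hW a (Finset.mem_insert_self _ _)
    have hf' := fun i hi => hf i (Finset.mem_insert_of_mem (a := i) (b := a) hi)
    have hW' := fun i hi => hW i (Finset.mem_insert_of_mem (a := i) (b := a) hi)
    rw [← ih hf' hW', ← mlieBracket_smul_right h1 h2]
    refine mlieBracket_add_right ?_ ?_
    · exact h1.smul_section h2
    · exact MDifferentiableAt.sum_section fun i hi => (hf' i hi).smul_section (hW' i hi)

/-- The derivative terms of the Leibniz rule are `(JX f) JW - J((JX f) W) - J((X f) JW) - (X f) W`,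
which vanishes because `J² = -1` at `x`. No smoothness of `J` itself is needed, only
differentiability of the fields `W i` and `J (W i)`. -/
theorem nijenhuis_sum_smul_right {ι : Type*} (s : Finset ι)
    (J : ∀ x : N, TangentSpace I x →L[ℝ] TangentSpace I x)
    (X : ∀ x : N, TangentSpace I x) {f : ι → N → ℝ} {W : ι → ∀ x : N, TangentSpace I x} {x : N}
    (hf : ∀ i ∈ s, MDifferentiableAt I 𝓘(ℝ, ℝ) (f i) x)
    (hW : ∀ i ∈ s, MDifferentiableAt I I.tangent (fun y => (W i y : TangentBundle I N)) x)
    (hJW : ∀ i ∈ s, MDifferentiableAt I I.tangent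
      (fun y => (J y (W i y) : TangentBundle I N)) x)
    (hJ : ∀ v : TangentSpace I x, J x (J x v) = -v) :
    nijenhuis I J X (fun y => ∑ i ∈ s, f i y • W i y) x
      = ∑ i ∈ s, f i x • nijenhuis I J X (W i) x := by
  unfold nijenhuis
  simp only [map_sum, map_smul]
  rw [mlieBracket_sum_smul_right s _ hf hJW, mlieBracket_sum_smul_right s _ hf hW,
    mlieBracket_sum_smul_right s _ hf hJW, mlieBracket_sum_smul_right s _ hf hW]
  simp only [map_sum, ← Finset.sum_sub_distrib]
  refine Finset.sum_congr rfl fun i _ => ?_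
  simp only [map_add, map_smul, hJ, smul_sub]
  module

end NijenhuisTensorial

/-! ### Coordinate fields and metric components in a chart of the base. -/

section ChartSmoothness

theorem sum_smul_stdVec {n : ℕ} (w : Rn n) : ∑ i, w i • (stdVec i : Rn n) = w := by
  ext j
  simp [stdVec, Finset.sum_apply, Pi.single_apply]

variable {n : ℕ} {M : Type*} [TopologicalSpace M] [ChartedSpace (Rn n) M]
  {e : OpenPartialHomeomorph M (Rn n)}

theorem mdifferentiable_of_mem_maximalAtlas (he : e ∈ IsManifold.maximalAtlas 𝓘(ℝ, Rn n) ∞ M) :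
    e.MDifferentiable 𝓘(ℝ, Rn n) 𝓘(ℝ, Rn n) :=
  ⟨(contMDiffOn_of_mem_maximalAtlas he).mdifferentiableOn (by simp),
    (contMDiffOn_symm_of_mem_maximalAtlas he).mdifferentiableOn (by simp)⟩

theorem isInvertible_mfderiv_chart (he : e ∈ IsManifold.maximalAtlas 𝓘(ℝ, Rn n) ∞ M) {x : M}
    (hx : x ∈ e.source) : (mfderiv 𝓘(ℝ, Rn n) 𝓘(ℝ, Rn n) e x).IsInvertible :=
  ⟨(mdifferentiable_of_mem_maximalAtlas he).mfderiv hx, rfl⟩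

theorem mfderiv_coordField (he : e ∈ IsManifold.maximalAtlas 𝓘(ℝ, Rn n) ∞ M) {x : M}
    (hx : x ∈ e.source) (i : Fin n) :
    mfderiv 𝓘(ℝ, Rn n) 𝓘(ℝ, Rn n) e x (coordField e i x) = (stdVec i : Rn n) := by
  exact (isInvertible_mfderiv_chart he hx).self_apply_inverse _

theorem sum_smul_coordField (he : e ∈ IsManifold.maximalAtlas 𝓘(ℝ, Rn n) ∞ M) {x : M}
    (hx : x ∈ e.source) (v : TangentSpace 𝓘(ℝ, Rn n) x) :
    ∑ i, (show Rn n from mfderiv 𝓘(ℝ, Rn n) 𝓘(ℝ, Rn n) e x v) i • coordField e i x = v := by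
  have hinv := isInvertible_mfderiv_chart he hx
  -- The differential of `e` is injective, so the two sides may be compared after applying it.
  rw [← hinv.inverse_apply_self (∑ i, _), ← hinv.inverse_apply_self v]
  congr 1
  simp only [map_sum, map_smul, mfderiv_coordField he hx]
  rw [hinv.inverse_apply_self]
  exact sum_smul_stdVec _

variable [IsManifold 𝓘(ℝ, Rn n) ∞ M]

theorem contMDiffAt_coordField (he : e ∈ IsManifold.maximalAtlas 𝓘(ℝ, Rn n) ∞ M) {x : M}
    (hx : x ∈ e.source) (i : Fin n) :
    ContMDiffAt 𝓘(ℝ, Rn n) 𝓘(ℝ, Rn n).tangent ∞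
      (fun y => (coordField e i y : TangentBundle 𝓘(ℝ, Rn n) M)) x := by
  refine ContMDiffAt.mpullback_vectorField_preimage (n := ∞) (V := fun _ => stdVec i) ?_
    (contMDiffAt_of_mem_maximalAtlas he hx) (isInvertible_mfderiv_chart he hx) (by simp)
  exact contMDiffAt_vectorSpace_iff_contDiffAt.2 contDiffAt_const

theorem contDiffAt_gDown (g : Metric n M) (he : e ∈ IsManifold.maximalAtlas 𝓘(ℝ, Rn n) ∞ M)
    {q : Rn n} (hq : q ∈ e.target) (i j : Fin n) :
    ContDiffAt ℝ ∞ (fun y => gDown g e y i j) q := by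
  have hx := e.map_target hq
  have h := ContMDiffAt.clm_bundle_apply₂ (E₃ := Bundle.Trivial M ℝ) (g.contMDiff (e.symm q))
    (contMDiffAt_coordField he hx i) (contMDiffAt_coordField he hx j)
  have h' : ContMDiffAt 𝓘(ℝ, Rn n) 𝓘(ℝ, ℝ) ∞
      (fun x => g.inner x (coordField e i x) (coordField e j x)) (e.symm q) :=
    (contMDiffAt_totalSpace.1 h).2
  exact (h'.comp q (contMDiffAt_symm_of_mem_maximalAtlas he hq)).contDiffAt

theorem gDown_symm (g : Metric n M) (e : OpenPartialHomeomorph M (Rn n)) (q : Rn n) (i j : Fin n) :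
    gDown g e q i j = gDown g e q j i := g.symm _ _ _

theorem gDown_dotProduct (g : Metric n M) (e : OpenPartialHomeomorph M (Rn n)) (q : Rn n)
    (v : Fin n → ℝ) :
    star v ⬝ᵥ (gDown g e q).mulVec v
      = g.inner (e.symm q) (∑ i, v i • coordField e i (e.symm q))
          (∑ i, v i • coordField e i (e.symm q)) := by
  simp only [dotProduct, Matrix.mulVec, gDown, Matrix.of_apply, map_sum, map_smul,
    _root_.sum_apply, _root_.smul_apply, smul_eq_mul, Finset.mul_sum]
  rw [Finset.sum_comm]
  refine Finset.sum_congr rfl fun i _ => Finset.sum_congr rfl fun j _ => ?_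
  simp; ring

/-- Valid at every `q`, even off `e.target` where the coordinate fields may fail to be a frame. This
keeps the energy nonnegative everywhere, as the chain rule on `[0, ∞)` requires. -/
theorem gDown_posSemidef (g : Metric n M) (e : OpenPartialHomeomorph M (Rn n)) (q : Rn n) :
    (gDown g e q).PosSemidef := by
  refine Matrix.PosSemidef.of_dotProduct_mulVec_nonneg ?_ fun v => ?_
  · ext i j
    simp [gDown_symm g e q i j]
  · rw [gDown_dotProduct]
    by_cases h : ∑ i, v i • coordField e i (e.symm q) = 0
    · simp [h]
    · exact (g.pos _ _ h).le

theorem gDown_posDef (g : Metric n M) (he : e ∈ IsManifold.maximalAtlas 𝓘(ℝ, Rn n) ∞ M)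
    {q : Rn n} (hq : q ∈ e.target) : (gDown g e q).PosDef := by
  refine Matrix.PosDef.of_dotProduct_mulVec_pos (gDown_posSemidef g e q).1 fun v hv => ?_
  rw [gDown_dotProduct]
  refine g.pos _ _ fun h => hv ?_
  -- The differential of `e` sends `∂_i` to the standard basis, so a vanishing combination of the
  -- `∂_i` has zero coefficients.
  have h2 := congrArg (mfderiv 𝓘(ℝ, Rn n) 𝓘(ℝ, Rn n) e (e.symm q)) h
  simp only [map_sum, map_smul, mfderiv_coordField he (e.map_target hq), map_zero] at h2
  funext i
  have h3 := congrArg (fun w : Rn n => w i) ((sum_smul_stdVec (WithLp.toLp 2 v)).symm.trans h2)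
  exact h3

end ChartSmoothness

/-! ### The induced chart of the cotangent bundle is a local diffeomorphism. -/

section InducedChart

variable {n : ℕ} {M : Type*} [TopologicalSpace M] [ChartedSpace (Rn n) M]
  {e : OpenPartialHomeomorph M (Rn n)}

/-- The covector with coordinates `(q, p)` in the chart induced by `e`. -/
def inducedChartSymm (e : OpenPartialHomeomorph M (Rn n)) (z : Rn n × Rn n) :
    CotangentBundle n M :=
  ⟨e.symm z.1, (innerSL ℝ z.2 : Rn n →L[ℝ] ℝ) ∘L mfderiv 𝓘(ℝ, Rn n) 𝓘(ℝ, Rn n) e (e.symm z.1)⟩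

theorem inducedChart_symm_apply (he : e ∈ IsManifold.maximalAtlas 𝓘(ℝ, Rn n) ∞ M)
    {z : Rn n × Rn n} (hz : z.1 ∈ e.target) : inducedChart e (inducedChartSymm e z) = z := by
  refine Prod.ext (e.right_inv hz) ?_
  ext i
  change innerSL ℝ z.2 (mfderiv 𝓘(ℝ, Rn n) 𝓘(ℝ, Rn n) e (e.symm z.1) (coordField e i (e.symm z.1))) = z.2 i
  rw [mfderiv_coordField he (e.map_target hz)]
  simp [stdVec, EuclideanSpace.inner_single_right]

theorem inducedChartSymm_apply (he : e ∈ IsManifold.maximalAtlas 𝓘(ℝ, Rn n) ∞ M)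
    {ξ : CotangentBundle n M} (hξ : ξ.proj ∈ e.source) :
    inducedChartSymm e (inducedChart e ξ) = ξ := by
  obtain ⟨x, φ⟩ := ξ
  have hx : e.symm (e x) = x := e.left_inv hξ
  have key : (innerSL ℝ (WithLp.toLp 2 fun i => φ (coordField e i x) : Rn n) : Rn n →L[ℝ] ℝ) ∘L
      mfderiv 𝓘(ℝ, Rn n) 𝓘(ℝ, Rn n) e x = φ := by
    ext v
    conv_rhs => rw [← sum_smul_coordField he hξ v]
    have h (f : Fin n → ℝ) (w : Rn n) : inner ℝ (WithLp.toLp 2 f : Rn n) w = ∑ i, w i * f i := by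
      simp [PiLp.inner_apply]
    simp only [map_sum, map_smul]
    exact h _ _
  change (⟨e.symm (e x), _⟩ : CotangentBundle n M) = _
  unfold inducedChart
  dsimp only
  rw [hx]
  exact congrArg _ key

variable [IsManifold 𝓘(ℝ, Rn n) ∞ M]

theorem contMDiffAt_inducedChart (he : e ∈ IsManifold.maximalAtlas 𝓘(ℝ, Rn n) ∞ M)
    {ξ : CotangentBundle n M} (hξ : ξ.proj ∈ e.source) :
    ContMDiffAt (cotModel n) 𝓘(ℝ, Rn n × Rn n) ∞ (inducedChart e) ξ := by
  have hproj : ContMDiffAt (cotModel n) 𝓘(ℝ, Rn n) ∞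
      (fun ζ : CotangentBundle n M => ζ.proj) ξ := contMDiff_proj _ ξ
  have h1 : ContMDiffAt (cotModel n) 𝓘(ℝ, Rn n) ∞
      (fun ζ : CotangentBundle n M => e ζ.proj) ξ :=
    (contMDiffAt_of_mem_maximalAtlas he hξ).comp ξ hproj
  have h2 (i : Fin n) : ContMDiffAt (cotModel n) 𝓘(ℝ, ℝ) ∞
      (fun ζ : CotangentBundle n M => ζ.snd (coordField e i ζ.proj)) ξ := by
    have hid : ContMDiffAt (cotModel n) (cotModel n) ∞
      (fun ζ : CotangentBundle n M => (⟨ζ.proj, ζ.snd⟩ : CotangentBundle n M)) ξ := contMDiffAt_id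
    have hc := (contMDiffAt_coordField he hξ i).comp ξ hproj
    have := ContMDiffAt.clm_bundle_apply (E₂ := Bundle.Trivial M ℝ) hid hc
    exact (contMDiffAt_totalSpace.1 this).2
  have h3 : ContMDiffAt (cotModel n) 𝓘(ℝ, Rn n) ∞
      (fun ζ : CotangentBundle n M =>
        (WithLp.toLp 2 fun i => ζ.snd (coordField e i ζ.proj) : Rn n)) ξ := by
    have : ContMDiffAt (cotModel n) 𝓘(ℝ, Fin n → ℝ) ∞
      (fun ζ : CotangentBundle n M => fun i => ζ.snd (coordField e i ζ.proj)) ξ :=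
        contMDiffAt_pi_space.2 h2
    exact ((PiLp.continuousLinearEquiv 2 ℝ (fun _ : Fin n => ℝ)).symm.contDiff.contMDiff.contMDiffAt).comp ξ this
  exact h1.prodMk_space h3

theorem contMDiffAt_inducedChartSymm (he : e ∈ IsManifold.maximalAtlas 𝓘(ℝ, Rn n) ∞ M)
    {z : Rn n × Rn n} (hz : z.1 ∈ e.target) :
    ContMDiffAt 𝓘(ℝ, Rn n × Rn n) (cotModel n) ∞ (inducedChartSymm e (M := M)) z := by
  have hb : ContMDiffAt 𝓘(ℝ, Rn n × Rn n) 𝓘(ℝ, Rn n) ∞ (fun z : Rn n × Rn n => e.symm z.1) z :=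
    (contMDiffAt_symm_of_mem_maximalAtlas he hz).comp z contDiff_fst.contMDiff.contMDiffAt
  refine (contMDiffAt_hom_bundle _).2 ⟨hb, ?_⟩
  have h1 := ((contMDiffAt_of_mem_maximalAtlas he (e.map_target hz)).mfderiv_const
    (m := ∞) (by simp)).comp z hb
  have h2 : ContMDiffAt 𝓘(ℝ, Rn n × Rn n) 𝓘(ℝ, Rn n →L[ℝ] ℝ) ∞
      (fun z : Rn n × Rn n => innerSL ℝ z.2) z :=
    ((innerSL ℝ).contDiff.comp contDiff_snd).contMDiff.contMDiffAt
  -- In the trivializations the covector reads as `⟨p, ·⟩` composed with the coordinate form of the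
  -- differential of `e`, and both factors depend smoothly on `z`.
  refine (h2.clm_comp h1).congr_of_eventuallyEq ?_
  refine Filter.Eventually.of_forall fun z' => ?_
  ext v
  simp [inducedChartSymm, inTangentCoordinates, ContinuousLinearMap.inCoordinates]
  rfl

/-- `inducedChart` and `inducedChartSymm` are smooth and mutually inverse near the points in
question; the chain rule makes their differentials inverse to each other. -/
theorem isInvertible_mfderiv_inducedChart (he : e ∈ IsManifold.maximalAtlas 𝓘(ℝ, Rn n) ∞ M)
    {ξ : CotangentBundle n M} (hξ : ξ.proj ∈ e.source) :
    (mfderiv (cotModel n) 𝓘(ℝ, Rn n × Rn n) (inducedChart e) ξ).IsInvertible := by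
  have hz : (inducedChart e ξ).1 ∈ e.target := e.map_source hξ
  have hF := (contMDiffAt_inducedChart he hξ).mdifferentiableAt (by simp)
  have hG := (contMDiffAt_inducedChartSymm (M := M) he hz).mdifferentiableAt (by simp)
  have hξ' := inducedChartSymm_apply he hξ
  have hF' : MDifferentiableAt (cotModel n) 𝓘(ℝ, Rn n × Rn n) (inducedChart e)
    (inducedChartSymm e (inducedChart e ξ)) := by rwa [hξ']
  have h1 := mfderiv_comp ξ hG hF
  have h2 := mfderiv_comp (inducedChart e ξ) hF' hG
  have e1 : inducedChartSymm e ∘ inducedChart e =ᶠ[nhds ξ] id := by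
    filter_upwards [(FiberBundle.continuous_proj _ _).continuousAt.preimage_mem_nhds
      (e.open_source.mem_nhds hξ)] with ζ hζ using inducedChartSymm_apply he hζ
  have e2 : inducedChart e ∘ inducedChartSymm (M := M) e =ᶠ[nhds (inducedChart e ξ)] id := by
    filter_upwards [continuous_fst.continuousAt.preimage_mem_nhds
      (e.open_target.mem_nhds hz)] with z hz using inducedChart_symm_apply he hz
  rw [e1.mfderiv_eq, mfderiv_id] at h1
  rw [e2.mfderiv_eq, mfderiv_id, hξ'] at h2
  exact .of_inverse h2.symm h1.symm

end InducedChart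

/-! ### Calculus of derivatives in a fixed direction. -/

section DirectionalDerivative

variable {E F : Type*} [NormedAddCommGroup E] [NormedSpace ℝ E]
  [NormedAddCommGroup F] [NormedSpace ℝ F]

/-- `f` is differentiable at `z`, with derivative `c` in the direction `w`. -/
def HasDirDeriv (f : E → ℝ) (z w : E) (c : ℝ) : Prop :=
  DifferentiableAt ℝ f z ∧ fderiv ℝ f z w = c

namespace HasDirDeriv

variable {f g : E → ℝ} {z w : E} {a b : ℝ}

theorem congr_deriv (h : HasDirDeriv f z w a) (hab : a = b) : HasDirDeriv f z w b := hab ▸ h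

theorem const (c : ℝ) : HasDirDeriv (fun _ : E => c) z w 0 :=
  ⟨differentiableAt_const c, by simp⟩

theorem add (hf : HasDirDeriv f z w a) (hg : HasDirDeriv g z w b) :
    HasDirDeriv (fun y => f y + g y) z w (a + b) :=
  ⟨hf.1.add hg.1, by rw [fderiv_fun_add hf.1 hg.1, add_apply, hf.2, hg.2]⟩

theorem mul (hf : HasDirDeriv f z w a) (hg : HasDirDeriv g z w b) :
    HasDirDeriv (fun y => f y * g y) z w (a * g z + f z * b) :=
  ⟨hf.1.mul hg.1, by
    rw [fderiv_fun_mul hf.1 hg.1]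
    simp only [add_apply, smul_apply, hf.2, hg.2, smul_eq_mul]
    ring⟩

theorem sum {ι : Type*} {s : Finset ι} {f : ι → E → ℝ} {a : ι → ℝ}
    (h : ∀ i ∈ s, HasDirDeriv (f i) z w (a i)) :
    HasDirDeriv (fun y => ∑ i ∈ s, f i y) z w (∑ i ∈ s, a i) := by
  refine ⟨DifferentiableAt.fun_sum fun i hi => (h i hi).1, ?_⟩
  rw [fderiv_fun_sum fun i hi => (h i hi).1, sum_apply]
  exact Finset.sum_congr rfl fun i hi => (h i hi).2

theorem inv (hf : HasDirDeriv f z w a) (h0 : f z ≠ 0) :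
    HasDirDeriv (fun y => (f y)⁻¹) z w (-a / f z ^ 2) := by
  refine ⟨hf.1.inv h0, ?_⟩
  have := (hasDerivAt_inv h0).comp_hasFDerivAt z hf.1.hasFDerivAt
  rw [show (fun y => (f y)⁻¹) = (fun x => x⁻¹) ∘ f from rfl, this.fderiv, smul_apply, hf.2,
    smul_eq_mul]
  ring

theorem comp_fst {φ : E → ℝ} {z w : E × F} (h : DifferentiableAt ℝ φ z.1) :
    HasDirDeriv (fun y : E × F => φ y.1) z w (fderiv ℝ φ z.1 w.1) := by
  have := h.hasFDerivAt.comp z (hasFDerivAt_fst (𝕜 := ℝ) (p := z))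
  exact ⟨this.differentiableAt, by
    rw [show (fun y : E × F => φ y.1) = φ ∘ Prod.fst from rfl, this.fderiv]; rfl⟩

theorem snd_apply {n : ℕ} {z w : E × Rn n} (i : Fin n) :
    HasDirDeriv (fun y : E × Rn n => y.2 i) z w (w.2 i) := by
  have : HasFDerivAt (fun y : E × Rn n => y.2 i)
      ((EuclideanSpace.proj i : Rn n →L[ℝ] ℝ) ∘L ContinuousLinearMap.snd ℝ E (Rn n)) z :=
    ((EuclideanSpace.proj i : Rn n →L[ℝ] ℝ) ∘L ContinuousLinearMap.snd ℝ E (Rn n)).hasFDerivAt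
  exact ⟨this.differentiableAt, by rw [this.fderiv]; rfl⟩

/-- The chain rule for a function differentiable on `[0, ∞)` and a nonnegative inner function. -/
theorem comp_halfLine {φ : ℝ → ℝ} (hφ : DifferentiableOn ℝ φ (Ici 0)) (hf : HasDirDeriv f z w a)
    (h0 : ∀ y, 0 ≤ f y) : HasDirDeriv (fun y => φ (f y)) z w (derivHalfLine φ (f z) * a) := by
  have h1 := (hφ (f z) (h0 z)).hasDerivWithinAt.hasFDerivWithinAt
  -- `f` maps the whole space into `[0, ∞)`, so the one-sided derivative of `φ` composes to a full
  -- derivative, also where `f` vanishes.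
  have h2 := h1.comp z hf.1.hasFDerivAt.hasFDerivWithinAt (s := univ) (fun y _ => h0 y)
  rw [hasFDerivWithinAt_univ] at h2
  refine ⟨h2.differentiableAt, ?_⟩
  rw [show (fun y => φ (f y)) = φ ∘ f from rfl, h2.fderiv]
  simp [hf.2, derivHalfLine, mul_comm]

end HasDirDeriv

end DirectionalDerivative

/-! ### The inverse metric, Christoffel symbols and parallelism of the metric. -/

section LeviCivita

variable {n : ℕ} {M : Type*} [TopologicalSpace M] [ChartedSpace (Rn n) M]
  [IsManifold 𝓘(ℝ, Rn n) ∞ M] {e : OpenPartialHomeomorph M (Rn n)}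

theorem gDown_mul_gUp (g : Metric n M) (he : e ∈ IsManifold.maximalAtlas 𝓘(ℝ, Rn n) ∞ M)
    {q : Rn n} (hq : q ∈ e.target) : gDown g e q * gUp g e q = 1 :=
  Matrix.mul_nonsing_inv _ (gDown_posDef g he hq).det_pos.ne'.isUnit

theorem gUp_mul_gDown (g : Metric n M) (he : e ∈ IsManifold.maximalAtlas 𝓘(ℝ, Rn n) ∞ M)
    {q : Rn n} (hq : q ∈ e.target) : gUp g e q * gDown g e q = 1 :=
  Matrix.nonsing_inv_mul _ (gDown_posDef g he hq).det_pos.ne'.isUnit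

theorem gUp_symm (g : Metric n M) (e : OpenPartialHomeomorph M (Rn n)) (q : Rn n) (i j : Fin n) :
    gUp g e q i j = gUp g e q j i := by
  have h : (gUp g e q).IsHermitian := (gDown_posSemidef g e q).1.inv
  simpa using (h.apply i j).symm

/-- Cramer's rule: the inverse is the adjugate over a nonvanishing determinant, both polynomial in
the `g_ij`. -/
theorem contDiffAt_gUp (g : Metric n M) (he : e ∈ IsManifold.maximalAtlas 𝓘(ℝ, Rn n) ∞ M)
    {q : Rn n} (hq : q ∈ e.target) (i j : Fin n) :
    ContDiffAt ℝ ∞ (fun y => gUp g e y i j) q := by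
  have hdet {f : Rn n → Matrix (Fin n) (Fin n) ℝ}
      (hf : ∀ i j, ContDiffAt ℝ ∞ (fun y => f y i j) q) :
      ContDiffAt ℝ ∞ (fun y => (f y).det) q := by
    simp only [Matrix.det_apply]
    exact ContDiffAt.sum fun σ _ => (contDiffAt_prod fun i _ => hf _ _).const_smul _
  have hg := contDiffAt_gDown g he hq
  have h0 : (gDown g e q).det ≠ 0 := (gDown_posDef g he hq).det_pos.ne'
  have hadj : ContDiffAt ℝ ∞ (fun y => (gDown g e y).adjugate i j) q := by
    simp only [Matrix.adjugate_apply]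
    refine hdet fun a b => ?_
    by_cases h : a = j
    · subst h; simpa using contDiffAt_const
    · simpa [Matrix.updateRow_ne h] using hg a b
  have := ((hdet hg).inv h0).mul hadj
  refine this.congr_of_eventuallyEq (Filter.Eventually.of_forall fun y => ?_)
  simp [gUp, Matrix.inv_def]

theorem contDiffAt_pd {f : Rn n → ℝ} {q : Rn n} (hf : ContDiffAt ℝ ∞ f q) (i : Fin n) :
    ContDiffAt ℝ ∞ (pd i f) q :=
  (hf.fderiv_right (m := ∞) (by simp)).clm_apply contDiffAt_const

theorem contDiffAt_christoffel (g : Metric n M)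
    (he : e ∈ IsManifold.maximalAtlas 𝓘(ℝ, Rn n) ∞ M)
    {q : Rn n} (hq : q ∈ e.target) (k i j : Fin n) :
    ContDiffAt ℝ ∞ (christoffel g e k i j) q := by
  have hg := contDiffAt_gDown g he hq
  exact contDiffAt_const.mul (ContDiffAt.sum fun l _ => (contDiffAt_gUp g he hq k l).mul
    (((contDiffAt_pd (hg j l) i).add (contDiffAt_pd (hg i l) j)).sub (contDiffAt_pd (hg i j) l)))

theorem christoffel_symm (g : Metric n M) (e : OpenPartialHomeomorph M (Rn n)) (k i j : Fin n)
    (q : Rn n) : christoffel g e k i j q = christoffel g e k j i q := by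
  unfold christoffel
  simp only [fun y => gDown_symm g e y i j]
  congr 1
  exact Finset.sum_congr rfl fun l _ => by ring

theorem sum_gDown_mul_gUp (g : Metric n M) (he : e ∈ IsManifold.maximalAtlas 𝓘(ℝ, Rn n) ∞ M)
    {q : Rn n} (hq : q ∈ e.target) (i k : Fin n) :
    ∑ j, gDown g e q i j * gUp g e q j k = if i = k then 1 else 0 := by
  rw [← Matrix.mul_apply, gDown_mul_gUp g he hq, Matrix.one_apply]

theorem sum_gDown_mul_christoffel (g : Metric n M)
    (he : e ∈ IsManifold.maximalAtlas 𝓘(ℝ, Rn n) ∞ M) {q : Rn n} (hq : q ∈ e.target)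
    (m i j : Fin n) :
    ∑ k, gDown g e q m k * christoffel g e k i j q
      = (1 / 2) * (pd i (fun y => gDown g e y j m) q + pd j (fun y => gDown g e y i m) q
          - pd m (fun y => gDown g e y i j) q) := by
  unfold christoffel
  simp only [Finset.mul_sum]
  rw [Finset.sum_comm]
  have (l : Fin n) (c : ℝ) : ∑ k, gDown g e q m k * ((1 / 2) * (gUp g e q k l * c))
      = (1 / 2) * (if m = l then 1 else 0) * c := by
    rw [← sum_gDown_mul_gUp g he hq, Finset.mul_sum, Finset.sum_mul]
    exact Finset.sum_congr rfl fun k _ => by ring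
  simp only [this]
  simp

/-- The metric is parallel: `∂_i g_ab = Γ^l_ia g_lb + Γ^l_ib g_al`. -/
theorem pd_gDown (g : Metric n M) (he : e ∈ IsManifold.maximalAtlas 𝓘(ℝ, Rn n) ∞ M)
    {q : Rn n} (hq : q ∈ e.target) (i a b : Fin n) :
    pd i (fun y => gDown g e y a b) q
      = ∑ l, (christoffel g e l i a q * gDown g e q l b
          + christoffel g e l i b q * gDown g e q a l) := by
  rw [Finset.sum_add_distrib]
  have h1 := sum_gDown_mul_christoffel g he hq b i a
  have h2 := sum_gDown_mul_christoffel g he hq a i b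
  simp only [fun y => gDown_symm g e y b a] at h2
  have h3 : ∑ l, christoffel g e l i a q * gDown g e q l b
      = ∑ l, gDown g e q b l * christoffel g e l i a q :=
    Finset.sum_congr rfl fun l _ => by rw [gDown_symm g e q l b, mul_comm]
  simp only [fun l => mul_comm (christoffel g e l i b q) (gDown g e q a l)]
  rw [h3, h1, h2]
  ring

/-- The inverse metric is parallel: `∂_i g^ab = -(Γ^a_il g^lb + Γ^b_il g^al)`. -/
theorem pd_gUp (g : Metric n M) (he : e ∈ IsManifold.maximalAtlas 𝓘(ℝ, Rn n) ∞ M)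
    {q : Rn n} (hq : q ∈ e.target) (i a b : Fin n) :
    pd i (fun y => gUp g e y a b) q
      = -∑ l, (christoffel g e a i l q * gUp g e q l b
          + christoffel g e b i l q * gUp g e q a l) := by
  let P : Matrix (Fin n) (Fin n) ℝ := Matrix.of fun a b => pd i (fun y => gDown g e y a b) q
  let Q : Matrix (Fin n) (Fin n) ℝ := Matrix.of fun a b => pd i (fun y => gUp g e y a b) q
  let C : Matrix (Fin n) (Fin n) ℝ := Matrix.of fun a l => christoffel g e a i l q
  have hGs : (gDown g e q).transpose = gDown g e q := by ext a b; exact gDown_symm g e q b a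
  have hP : P = C.transpose * gDown g e q + gDown g e q * C := by
    ext a b
    simp only [P, C, Matrix.of_apply, pd_gDown g he hq, Matrix.add_apply, Matrix.mul_apply,
      Matrix.transpose_apply, ← Finset.sum_add_distrib]
    exact Finset.sum_congr rfl fun l _ => by ring
  -- Differentiating `g g⁻¹ = 1` along `x^i`, which holds throughout the open set `e.target`.
  -- Multiplying by `g⁻¹` on the left then solves for the derivative of `g⁻¹`.
  have hPQ : P * gUp g e q + gDown g e q * Q = 0 := by
    ext a b
    have hd : fderiv ℝ (fun y => ∑ l, gDown g e y a l * gUp g e y l b) q (stdVec i) = 0 := by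
      have : (fun y => ∑ l, gDown g e y a l * gUp g e y l b)
          =ᶠ[nhds q] fun _ => if a = b then 1 else 0 := by
        filter_upwards [e.open_target.mem_nhds hq] with y hy using sum_gDown_mul_gUp g he hy a b
      rw [this.fderiv_eq]; simp
    have hs := HasDirDeriv.sum (s := Finset.univ) (z := q) (w := (stdVec i : Rn n))
      fun l _ => HasDirDeriv.mul
        (⟨(contDiffAt_gDown g he hq a l).differentiableAt (by simp), rfl⟩)
        (⟨(contDiffAt_gUp g he hq l b).differentiableAt (by simp), rfl⟩)
    rw [hs.2, Finset.sum_add_distrib] at hd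
    simpa [P, Q, Matrix.mul_apply, pd] using hd
  have hU := gUp_mul_gDown g he hq
  have hG := gDown_mul_gUp g he hq
  have hQ : Q = -(gUp g e q * C.transpose + C * gUp g e q) := by
    have h1 : gUp g e q * (P * gUp g e q) + Q = 0 := by
      rw [← Matrix.one_mul Q, ← hU, Matrix.mul_assoc (gUp g e q) _ Q, ← Matrix.mul_add, hPQ,
        Matrix.mul_zero]
    have h2 : gUp g e q * (P * gUp g e q) = gUp g e q * C.transpose + C * gUp g e q := by
      rw [hP, Matrix.add_mul, Matrix.mul_add, Matrix.mul_assoc C.transpose, hG, Matrix.mul_one,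
        Matrix.mul_assoc (gDown g e q), ← Matrix.mul_assoc (gUp g e q) (gDown g e q), hU,
        Matrix.one_mul]
    rw [h2] at h1
    exact (neg_eq_of_add_eq_zero_right h1).symm
  have := congrFun (congrFun hQ a) b
  simp only [Q, C, Matrix.of_apply, Matrix.neg_apply, Matrix.add_apply, Matrix.mul_apply,
    Matrix.transpose_apply, ← Finset.sum_add_distrib] at this
  rw [this]
  congr 1
  exact Finset.sum_congr rfl fun l _ => by ring

end LeviCivita

/-! ### The coefficients of the frame and of `J` as functions of `(q, p)`, and their derivatives. -/

section Coordinates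

/-- The vector field on `ℝⁿ × ℝⁿ` with constant first component `c` and fibre components `a h`. -/
def fibreField {n : ℕ} (c : Rn n) (a : Fin n → Rn n × Rn n → ℝ) (z : Rn n × Rn n) : Rn n × Rn n :=
  (c, WithLp.toLp 2 fun h => a h z)

variable {n : ℕ} {M : Type*} [TopologicalSpace M] [ChartedSpace (Rn n) M]
  [IsManifold 𝓘(ℝ, Rn n) ∞ M]

/-- The raised fibre coordinates `g^{0i}` as functions of `(q, p)`. -/
def pUpAt (g : Metric n M) (e : OpenPartialHomeomorph M (Rn n)) (i : Fin n) (z : Rn n × Rn n) : ℝ :=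
  ∑ h, z.2 h * gUp g e z.1 h i

/-- The energy density as a function of `(q, p)`. -/
def energyAt (g : Metric n M) (e : OpenPartialHomeomorph M (Rn n)) (z : Rn n × Rn n) : ℝ :=
  (1 / 2) * ∑ i, ∑ k, gUp g e z.1 i k * z.2 i * z.2 k

/-- `J^{(1)}_ij` as a function of `(q, p)`. -/
def J₁At (g : Metric n M) (A : ℝ) (lam b₁ : ℝ → ℝ) (e : OpenPartialHomeomorph M (Rn n))
    (i j : Fin n) (z : Rn n × Rn n) : ℝ :=
  A / lam (energyAt g e z) * gDown g e z.1 i j + b₁ (energyAt g e z) * z.2 i * z.2 j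

/-- `J_{(2)}^ij` as a function of `(q, p)`. -/
def J₂At (g : Metric n M) (A : ℝ) (lam b₁ : ℝ → ℝ) (e : OpenPartialHomeomorph M (Rn n))
    (i j : Fin n) (z : Rn n × Rn n) : ℝ :=
  lam (energyAt g e z) / A * gUp g e z.1 i j
    + b₂ A lam b₁ (energyAt g e z) * pUpAt g e i z * pUpAt g e j z

/-- The fibre components `p_k Γ^k_ih` of `δ/δqⁱ`. -/
def horCoeff (g : Metric n M) (e : OpenPartialHomeomorph M (Rn n)) (i h : Fin n)
    (z : Rn n × Rn n) : ℝ :=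
  ∑ k, z.2 k * christoffel g e k i h z.1

theorem energyAt_nonneg (g : Metric n M) (e : OpenPartialHomeomorph M (Rn n)) (z : Rn n × Rn n) :
    0 ≤ energyAt g e z := by
  have h := (gDown_posSemidef g e z.1).inv.dotProduct_mulVec_nonneg z.2
  have h2 : star (z.2 : Fin n → ℝ) ⬝ᵥ (gDown g e z.1)⁻¹.mulVec z.2
      = ∑ i, ∑ k, gUp g e z.1 i k * z.2 i * z.2 k := by
    simp only [dotProduct, Matrix.mulVec, gUp, Finset.mul_sum]
    exact Finset.sum_congr rfl fun i _ => Finset.sum_congr rfl fun k _ => by simp; ring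
  unfold energyAt
  rw [← h2]
  linarith

theorem sum_pUpAt_mul (g : Metric n M) (e : OpenPartialHomeomorph M (Rn n)) (z : Rn n × Rn n) :
    ∑ l, pUpAt g e l z * z.2 l = 2 * energyAt g e z := by
  unfold pUpAt energyAt
  rw [← mul_assoc, show (2 : ℝ) * (1 / 2) = 1 by norm_num, one_mul]
  simp only [Finset.sum_mul]
  rw [Finset.sum_comm]
  exact Finset.sum_congr rfl fun i _ => Finset.sum_congr rfl fun k _ => by ring

variable {e : OpenPartialHomeomorph M (Rn n)}

theorem sum_gDown_mul_pUpAt (g : Metric n M) (he : e ∈ IsManifold.maximalAtlas 𝓘(ℝ, Rn n) ∞ M)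
    {z : Rn n × Rn n} (hz : z.1 ∈ e.target) (i : Fin n) :
    ∑ l, gDown g e z.1 i l * pUpAt g e l z = z.2 i := by
  unfold pUpAt
  simp only [Finset.mul_sum]
  rw [Finset.sum_comm]
  have (k : Fin n) : ∑ l, gDown g e z.1 i l * (z.2 k * gUp g e z.1 k l)
      = z.2 k * (if i = k then 1 else 0) := by
    rw [← sum_gDown_mul_gUp g he hz, Finset.mul_sum]
    exact Finset.sum_congr rfl fun l _ => by rw [gUp_symm g e z.1 k l]; ring
  simp [this]

/-- Serves twice: in inverting `J₁`, and in differentiating the energy along `J δ/δq^i`. -/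
theorem sum_J₁At_mul_pUpAt (g : Metric n M) (A : ℝ) (lam b₁ : ℝ → ℝ)
    (he : e ∈ IsManifold.maximalAtlas 𝓘(ℝ, Rn n) ∞ M)
    {z : Rn n × Rn n} (hz : z.1 ∈ e.target) (i : Fin n) :
    ∑ l, J₁At g A lam b₁ e i l z * pUpAt g e l z
      = (A / lam (energyAt g e z) + 2 * energyAt g e z * b₁ (energyAt g e z)) * z.2 i := by
  have h (a b : ℝ) : ∑ l, (a * gDown g e z.1 i l + b * z.2 i * z.2 l) * pUpAt g e l z
      = a * ∑ l, gDown g e z.1 i l * pUpAt g e l z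
        + b * z.2 i * ∑ l, pUpAt g e l z * z.2 l := by
    rw [Finset.mul_sum, Finset.mul_sum, ← Finset.sum_add_distrib]
    exact Finset.sum_congr rfl fun l _ => by ring
  unfold J₁At
  rw [h, sum_gDown_mul_pUpAt g he hz, sum_pUpAt_mul]
  ring

theorem J₁At_symm (g : Metric n M) (A : ℝ) (lam b₁ : ℝ → ℝ) (e : OpenPartialHomeomorph M (Rn n))
    (i j : Fin n) (z : Rn n × Rn n) : J₁At g A lam b₁ e i j z = J₁At g A lam b₁ e j i z := by
  unfold J₁At
  rw [gDown_symm]; ring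

theorem J₂At_symm (g : Metric n M) (A : ℝ) (lam b₁ : ℝ → ℝ) (e : OpenPartialHomeomorph M (Rn n))
    (i j : Fin n) (z : Rn n × Rn n) : J₂At g A lam b₁ e i j z = J₂At g A lam b₁ e j i z := by
  unfold J₂At
  rw [gUp_symm]; ring

theorem sum_J₁At_mul_J₂At (g : Metric n M) {A : ℝ} {lam b₁ : ℝ → ℝ} (hA : 0 < A)
    (hlam_pos : ∀ t, 0 ≤ t → 0 < lam t) (hpos : ∀ t, 0 ≤ t → 0 < A + 2 * t * lam t * b₁ t)
    (he : e ∈ IsManifold.maximalAtlas 𝓘(ℝ, Rn n) ∞ M)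
    {z : Rn n × Rn n} (hz : z.1 ∈ e.target) (i k : Fin n) :
    ∑ j, J₁At g A lam b₁ e i j z * J₂At g A lam b₁ e j k z = if i = k then 1 else 0 := by
  have ht := energyAt_nonneg g e z
  have hl := (hlam_pos _ ht).ne'
  have hp := (hpos _ ht).ne'
  have hA' := hA.ne'
  have h1 : ∑ j, J₁At g A lam b₁ e i j z * J₂At g A lam b₁ e j k z
      = lam (energyAt g e z) / A * ∑ j, J₁At g A lam b₁ e i j z * gUp g e z.1 j k
        + b₂ A lam b₁ (energyAt g e z) * pUpAt g e k z *
          ∑ j, J₁At g A lam b₁ e i j z * pUpAt g e j z := by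
    rw [Finset.mul_sum, Finset.mul_sum, ← Finset.sum_add_distrib]
    exact Finset.sum_congr rfl fun j _ => by unfold J₂At; ring
  have h2 : ∑ j, J₁At g A lam b₁ e i j z * gUp g e z.1 j k
      = A / lam (energyAt g e z) * ∑ j, gDown g e z.1 i j * gUp g e z.1 j k
        + b₁ (energyAt g e z) * z.2 i * pUpAt g e k z := by
    unfold pUpAt
    rw [Finset.mul_sum, Finset.mul_sum, ← Finset.sum_add_distrib]
    exact Finset.sum_congr rfl fun j _ => by unfold J₁At; ring
  rw [h1, h2, sum_gDown_mul_gUp g he hz, sum_J₁At_mul_pUpAt g A lam b₁ he hz, b₂]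
  generalize (if i = k then (1 : ℝ) else 0) = δ
  -- The coefficient `b₂` is chosen so that `b₂ (A/λ + 2t b₁) = -λ b₁/A`, which cancels the rank-one
  -- part `p_i g^{0k}` of the product.
  have hb {L B t : ℝ} (hL : L ≠ 0) (h : A + 2 * t * L * B ≠ 0) :
      -(L ^ 2 * B) / (A * (A + 2 * t * L * B)) * (A / L + 2 * t * B) = -(L * B / A) := by
    have : A / L + 2 * t * B = (A + 2 * t * L * B) / L := by field_simp
    rw [this]
    generalize A + 2 * t * L * B = X at h ⊢
    field_simp
  have hc : lam (energyAt g e z) / A * (A / lam (energyAt g e z)) = 1 := by field_simp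
  linear_combination pUpAt g e k z * z.2 i * hb hl hp + δ * hc

theorem sum_J₂At_mul_J₁At (g : Metric n M) {A : ℝ} {lam b₁ : ℝ → ℝ} (hA : 0 < A)
    (hlam_pos : ∀ t, 0 ≤ t → 0 < lam t) (hpos : ∀ t, 0 ≤ t → 0 < A + 2 * t * lam t * b₁ t)
    (he : e ∈ IsManifold.maximalAtlas 𝓘(ℝ, Rn n) ∞ M)
    {z : Rn n × Rn n} (hz : z.1 ∈ e.target) (i k : Fin n) :
    ∑ j, J₂At g A lam b₁ e i j z * J₁At g A lam b₁ e j k z = if i = k then 1 else 0 := by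
  have := sum_J₁At_mul_J₂At g hA hlam_pos hpos he hz k i
  rw [show (if i = k then (1 : ℝ) else 0) = if k = i then 1 else 0 by simp only [eq_comm], ← this]
  refine Finset.sum_congr rfl fun j _ => ?_
  rw [J₁At_symm g A lam b₁ e j k, J₂At_symm g A lam b₁ e i j, mul_comm]

/-! ### Derivatives along vertical and horizontal directions -/

theorem hasDirDeriv_gUp (g : Metric n M) (he : e ∈ IsManifold.maximalAtlas 𝓘(ℝ, Rn n) ∞ M)
    {z : Rn n × Rn n} (hz : z.1 ∈ e.target) (w : Rn n × Rn n) (i k : Fin n) :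
    HasDirDeriv (fun y : Rn n × Rn n => gUp g e y.1 i k) z w
      (fderiv ℝ (fun q => gUp g e q i k) z.1 w.1) :=
  HasDirDeriv.comp_fst (φ := fun q => gUp g e q i k)
    ((contDiffAt_gUp g he hz i k).differentiableAt (by simp))

theorem hasDirDeriv_gDown (g : Metric n M) (he : e ∈ IsManifold.maximalAtlas 𝓘(ℝ, Rn n) ∞ M)
    {z : Rn n × Rn n} (hz : z.1 ∈ e.target) (w : Rn n × Rn n) (i k : Fin n) :
    HasDirDeriv (fun y : Rn n × Rn n => gDown g e y.1 i k) z w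
      (fderiv ℝ (fun q => gDown g e q i k) z.1 w.1) :=
  HasDirDeriv.comp_fst (φ := fun q => gDown g e q i k)
    ((contDiffAt_gDown g he hz i k).differentiableAt (by simp))

theorem hasDirDeriv_horCoeff (g : Metric n M) (he : e ∈ IsManifold.maximalAtlas 𝓘(ℝ, Rn n) ∞ M)
    {z : Rn n × Rn n} (hz : z.1 ∈ e.target) (w : Rn n × Rn n) (i h : Fin n) :
    HasDirDeriv (horCoeff g e i h) z w
      (∑ k, (w.2 k * christoffel g e k i h z.1
        + z.2 k * fderiv ℝ (christoffel g e k i h) z.1 w.1)) :=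
  HasDirDeriv.sum fun k _ => (HasDirDeriv.snd_apply k).mul
    (HasDirDeriv.comp_fst ((contDiffAt_christoffel g he hz k i h).differentiableAt (by simp)))

theorem hasDirDeriv_energyAt (g : Metric n M) (he : e ∈ IsManifold.maximalAtlas 𝓘(ℝ, Rn n) ∞ M)
    {z : Rn n × Rn n} (hz : z.1 ∈ e.target) (w : Rn n × Rn n) :
    HasDirDeriv (energyAt g e) z w
      ((1 / 2) * ∑ i, ∑ k, ((fderiv ℝ (fun q => gUp g e q i k) z.1 w.1 * z.2 i
        + gUp g e z.1 i k * w.2 i) * z.2 k + gUp g e z.1 i k * z.2 i * w.2 k)) := by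
  refine ((HasDirDeriv.const (1 / 2)).mul (HasDirDeriv.sum fun i _ => HasDirDeriv.sum fun k _ =>
    ((hasDirDeriv_gUp g he hz w i k).mul (HasDirDeriv.snd_apply i)).mul
      (HasDirDeriv.snd_apply k))).congr_deriv ?_
  rw [zero_mul, zero_add]

/-- `∂t/∂p_l = g^{0l}`: the two halves of the product rule agree by symmetry of `g^{ik}` and absorb
the factor `1/2`. -/
theorem hasDirDeriv_energyAt_vertical (g : Metric n M)
    (he : e ∈ IsManifold.maximalAtlas 𝓘(ℝ, Rn n) ∞ M)
    {z : Rn n × Rn n} (hz : z.1 ∈ e.target) (v : Rn n) :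
    HasDirDeriv (energyAt g e) z (0, v) (∑ l, v l * pUpAt g e l z) := by
  refine (hasDirDeriv_energyAt g he hz (0, v)).congr_deriv ?_
  have h : ∑ l, v l * pUpAt g e l z = ∑ i, ∑ k, gUp g e z.1 i k * z.2 i * v k := by
    rw [Finset.sum_comm]
    refine Finset.sum_congr rfl fun l _ => ?_
    rw [pUpAt, Finset.mul_sum]
    exact Finset.sum_congr rfl fun k _ => by ring
  have h' : ∑ l, v l * pUpAt g e l z = ∑ i, ∑ k, gUp g e z.1 i k * v i * z.2 k := by
    refine Finset.sum_congr rfl fun l _ => ?_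
    rw [pUpAt, Finset.mul_sum]
    exact Finset.sum_congr rfl fun k _ => by rw [gUp_symm]; ring
  simp only [map_zero, zero_mul, zero_add, Finset.sum_add_distrib]
  rw [← h, ← h']
  ring

/-- The two Christoffel terms of `∂_a g^{ik}` cancel against the two from `δ_a p_i = p_m Γ^m_ai`. -/
theorem hasDirDeriv_energyAt_horField (g : Metric n M)
    (he : e ∈ IsManifold.maximalAtlas 𝓘(ℝ, Rn n) ∞ M)
    {z : Rn n × Rn n} (hz : z.1 ∈ e.target) (a : Fin n) :
    HasDirDeriv (energyAt g e) z (fibreField (stdVec a) (horCoeff g e a) z) 0 := by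
  refine (hasDirDeriv_energyAt g he hz _).congr_deriv ?_
  have hd (i k : Fin n) : fderiv ℝ (fun q => gUp g e q i k) z.1 (stdVec a)
      = -∑ l, (christoffel g e i a l z.1 * gUp g e z.1 l k
          + christoffel g e k a l z.1 * gUp g e z.1 i l) := pd_gUp g he hz a i k
  simp only [fibreField, hd, horCoeff]
  have e1 : ∑ i, ∑ k, ∑ l, christoffel g e i a l z.1 * gUp g e z.1 l k * z.2 i * z.2 k
      = ∑ i, ∑ k, gUp g e z.1 i k * (∑ m, z.2 m * christoffel g e m a i z.1) * z.2 k := by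
    simp only [Finset.mul_sum, Finset.sum_mul]
    rw [Finset.sum_comm]
    conv_rhs => rw [Finset.sum_comm]
    refine Finset.sum_congr rfl fun k _ => ?_
    rw [Finset.sum_comm]
    exact Finset.sum_congr rfl fun l _ => Finset.sum_congr rfl fun i _ => by ring
  have e2 : ∑ i, ∑ k, ∑ l, christoffel g e k a l z.1 * gUp g e z.1 i l * z.2 i * z.2 k
      = ∑ i, ∑ k, gUp g e z.1 i k * z.2 i * (∑ m, z.2 m * christoffel g e m a k z.1) := by
    simp only [Finset.mul_sum]
    refine Finset.sum_congr rfl fun i _ => ?_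
    rw [Finset.sum_comm]
    exact Finset.sum_congr rfl fun l _ => Finset.sum_congr rfl fun i _ => by ring
  have e3 : ∑ i, ∑ k, (-∑ l, (christoffel g e i a l z.1 * gUp g e z.1 l k
          + christoffel g e k a l z.1 * gUp g e z.1 i l)) * z.2 i * z.2 k
      = -(∑ i, ∑ k, ∑ l, christoffel g e i a l z.1 * gUp g e z.1 l k * z.2 i * z.2 k
        + ∑ i, ∑ k, ∑ l, christoffel g e k a l z.1 * gUp g e z.1 i l * z.2 i * z.2 k) := by
    simp only [← Finset.sum_add_distrib, ← Finset.sum_neg_distrib, Finset.sum_mul]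
    exact Finset.sum_congr rfl fun i _ => Finset.sum_congr rfl fun k _ =>
      Finset.sum_congr rfl fun l _ => by ring
  simp only [add_mul, Finset.sum_add_distrib (f := fun k => _ + _), Finset.sum_add_distrib]
  simp only [Finset.sum_add_distrib] at e3
  rw [e3, e1, e2]
  ring

theorem hasDirDeriv_J₁At (g : Metric n M) {A : ℝ} {lam b₁ : ℝ → ℝ}
    (hlam : DifferentiableOn ℝ lam (Ici 0)) (hb₁ : DifferentiableOn ℝ b₁ (Ici 0))
    (hlam_pos : ∀ t, 0 ≤ t → 0 < lam t)
    (he : e ∈ IsManifold.maximalAtlas 𝓘(ℝ, Rn n) ∞ M)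
    {z : Rn n × Rn n} (hz : z.1 ∈ e.target) {w : Rn n × Rn n} {c : ℝ}
    (hc : HasDirDeriv (energyAt g e) z w c) (j k : Fin n) :
    HasDirDeriv (J₁At g A lam b₁ e j k) z w
      (-(A * derivHalfLine lam (energyAt g e z) / lam (energyAt g e z) ^ 2) * c
          * gDown g e z.1 j k
        + A / lam (energyAt g e z) * fderiv ℝ (fun q => gDown g e q j k) z.1 w.1
        + derivHalfLine b₁ (energyAt g e z) * c * z.2 j * z.2 k
        + b₁ (energyAt g e z) * (w.2 j * z.2 k + z.2 j * w.2 k)) := by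
  have ht := energyAt_nonneg g e
  refine ((((HasDirDeriv.const A).mul ((hc.comp_halfLine hlam ht).inv
    (hlam_pos _ (ht z)).ne')).mul (hasDirDeriv_gDown g he hz w j k)).add
    (((hc.comp_halfLine hb₁ ht).mul (HasDirDeriv.snd_apply j)).mul
      (HasDirDeriv.snd_apply k))).congr_deriv ?_
  ring

/-- Since the energy is horizontally constant, `λ` and `b₁` are not differentiated; each lower index
of `g_jk` and `p_j p_k` contributes one Christoffel term. -/
theorem hasDirDeriv_J₁At_horField (g : Metric n M) {A : ℝ} {lam b₁ : ℝ → ℝ}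
    (hlam : DifferentiableOn ℝ lam (Ici 0)) (hb₁ : DifferentiableOn ℝ b₁ (Ici 0))
    (hlam_pos : ∀ t, 0 ≤ t → 0 < lam t)
    (he : e ∈ IsManifold.maximalAtlas 𝓘(ℝ, Rn n) ∞ M)
    {z : Rn n × Rn n} (hz : z.1 ∈ e.target) (i j k : Fin n) :
    HasDirDeriv (J₁At g A lam b₁ e j k) z (fibreField (stdVec i) (horCoeff g e i) z)
      (∑ l, (christoffel g e l i j z.1 * J₁At g A lam b₁ e l k z
        + christoffel g e l i k z.1 * J₁At g A lam b₁ e j l z)) := by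
  refine (hasDirDeriv_J₁At g hlam hb₁ hlam_pos he hz
    (hasDirDeriv_energyAt_horField g he hz i) j k).congr_deriv ?_
  have hd : fderiv ℝ (fun q => gDown g e q j k) z.1 (stdVec i) = _ := pd_gDown g he hz i j k
  simp only [fibreField, hd, horCoeff, J₁At, mul_zero, zero_mul, zero_add, add_zero]
  simp only [Finset.mul_sum, Finset.sum_mul, ← Finset.sum_add_distrib]
  exact Finset.sum_congr rfl fun l _ => by ring

theorem hasDirDeriv_J₁At_vertical (g : Metric n M) {A : ℝ} {lam b₁ : ℝ → ℝ}
    (hlam : DifferentiableOn ℝ lam (Ici 0)) (hb₁ : DifferentiableOn ℝ b₁ (Ici 0))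
    (hlam_pos : ∀ t, 0 ≤ t → 0 < lam t)
    (he : e ∈ IsManifold.maximalAtlas 𝓘(ℝ, Rn n) ∞ M)
    {z : Rn n × Rn n} (hz : z.1 ∈ e.target) (i j k : Fin n) :
    HasDirDeriv (J₁At g A lam b₁ e j k) z (fibreField 0 (J₁At g A lam b₁ e i) z)
      (-(A * derivHalfLine lam (energyAt g e z) / lam (energyAt g e z) ^ 2)
          * ((A / lam (energyAt g e z) + 2 * energyAt g e z * b₁ (energyAt g e z)) * z.2 i)
          * gDown g e z.1 j k
        + derivHalfLine b₁ (energyAt g e z)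
          * ((A / lam (energyAt g e z) + 2 * energyAt g e z * b₁ (energyAt g e z)) * z.2 i)
          * z.2 j * z.2 k
        + b₁ (energyAt g e z)
          * (J₁At g A lam b₁ e i j z * z.2 k + z.2 j * J₁At g A lam b₁ e i k z)) := by
  have hc := (hasDirDeriv_energyAt_vertical g he hz
    (WithLp.toLp 2 fun h => J₁At g A lam b₁ e i h z)).congr_deriv
    (sum_J₁At_mul_pUpAt g A lam b₁ he hz i)
  refine (hasDirDeriv_J₁At g hlam hb₁ hlam_pos he hz hc j k).congr_deriv ?_
  simp

theorem differentiableAt_J₂At (g : Metric n M) {A : ℝ} {lam b₁ : ℝ → ℝ} (hA : 0 < A)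
    (hlam : DifferentiableOn ℝ lam (Ici 0)) (hb₁ : DifferentiableOn ℝ b₁ (Ici 0))
    (hpos : ∀ t, 0 ≤ t → 0 < A + 2 * t * lam t * b₁ t)
    (he : e ∈ IsManifold.maximalAtlas 𝓘(ℝ, Rn n) ∞ M)
    {z : Rn n × Rn n} (hz : z.1 ∈ e.target) (i j : Fin n) :
    DifferentiableAt ℝ (J₂At g A lam b₁ e i j) z := by
  have ht := energyAt_nonneg g e
  -- Only differentiability is extracted, so the direction `0` is arbitrary.
  have hc := hasDirDeriv_energyAt g he hz 0
  have h1 := (hc.comp_halfLine hlam ht).1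
  have h2 := (hc.comp_halfLine hb₁ ht).1
  have h3 := hc.1
  have h4 (i k : Fin n) := (hasDirDeriv_gUp g he hz 0 i k).1
  have h5 (i : Fin n) : DifferentiableAt ℝ (pUpAt g e i) z :=
    DifferentiableAt.fun_sum fun h _ =>
      ((HasDirDeriv.snd_apply (E := Rn n) (z := z) (w := 0) h).1).mul (h4 h i)
  have h0 : A * (A + 2 * energyAt g e z * lam (energyAt g e z) * b₁ (energyAt g e z)) ≠ 0 :=
    mul_ne_zero hA.ne' (hpos _ (ht z)).ne'
  have hd : DifferentiableAt ℝ (fun y => A * (A + 2 * energyAt g e y * lam (energyAt g e y)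
      * b₁ (energyAt g e y))) z :=
    (((h3.const_mul 2).mul h1).mul h2).const_add A |>.const_mul A
  have hn : DifferentiableAt ℝ (fun y => -(lam (energyAt g e y) ^ 2 * b₁ (energyAt g e y))) z :=
    ((h1.pow 2).mul h2).neg
  have h6 : DifferentiableAt ℝ (fun y => b₂ A lam b₁ (energyAt g e y)) z := by
    simpa only [b₂, div_eq_mul_inv] using! hn.mul (hd.inv h0)
  have h7 : DifferentiableAt ℝ (fun y => lam (energyAt g e y) / A) z := by
    simpa only [div_eq_mul_inv] using h1.mul_const A⁻¹
  exact (h7.mul (h4 i j)).add ((h6.mul (h5 i)).mul (h5 j))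

/-- The horizontal fields have curvature as their bracket:
`δ_i (p_h Γ^h_jk) - δ_j (p_h Γ^h_ik) = p_h R^h_kij`. -/
theorem sum_curvature_mul (g : Metric n M) (e : OpenPartialHomeomorph M (Rn n))
    (z : Rn n × Rn n) (i j k : Fin n) :
    ∑ h, (horCoeff g e i h z * christoffel g e h j k z.1
        + z.2 h * fderiv ℝ (christoffel g e h j k) z.1 (stdVec i))
      - ∑ h, (horCoeff g e j h z * christoffel g e h i k z.1
        + z.2 h * fderiv ℝ (christoffel g e h i k) z.1 (stdVec j))
      = ∑ h, curvature g e h k i j z.1 * z.2 h := by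
  have hs (i j : Fin n) : ∑ h, horCoeff g e i h z * christoffel g e h j k z.1
      = ∑ h, (∑ l, christoffel g e h i l z.1 * christoffel g e l j k z.1) * z.2 h := by
    simp only [horCoeff, Finset.sum_mul]
    rw [Finset.sum_comm]
    exact Finset.sum_congr rfl fun h _ => Finset.sum_congr rfl fun l _ => by ring
  rw [Finset.sum_add_distrib, Finset.sum_add_distrib, hs, hs]
  simp only [← Finset.sum_add_distrib, ← Finset.sum_sub_distrib]
  refine Finset.sum_congr rfl fun h _ => ?_
  simp only [curvature, pd, Finset.sum_sub_distrib]
  ring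

end Coordinates

/-! ### Lie brackets of fields pulled back by the induced chart. -/

section Brackets

variable {n : ℕ}

theorem hasFDerivAt_fibreField {c : Rn n} {a : Fin n → Rn n × Rn n → ℝ} {z : Rn n × Rn n}
    (ha : ∀ h, DifferentiableAt ℝ (a h) z) :
    HasFDerivAt (fibreField c a) ((0 : Rn n × Rn n →L[ℝ] Rn n).prod
      (((PiLp.continuousLinearEquiv 2 ℝ (fun _ : Fin n => ℝ)).symm : (Fin n → ℝ) →L[ℝ] Rn n) ∘L
        ContinuousLinearMap.pi fun h => fderiv ℝ (a h) z)) z :=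
  (hasFDerivAt_const c z).prodMk
    ((PiLp.continuousLinearEquiv 2 ℝ (fun _ : Fin n => ℝ)).symm.hasFDerivAt.comp z
      (hasFDerivAt_pi.2 fun h => (ha h).hasFDerivAt))

/-- The base components are constant, so the bracket is vertical, and each fibre component needs
just one directional derivative of each field. -/
theorem lieBracket_fibreField {c c' : Rn n} {a b : Fin n → Rn n × Rn n → ℝ} {z : Rn n × Rn n}
    {da db : Fin n → ℝ} (ha : ∀ h, HasDirDeriv (a h) z (fibreField c' b z) (da h))
    (hb : ∀ h, HasDirDeriv (b h) z (fibreField c a z) (db h)) :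
    lieBracket ℝ (fibreField c a) (fibreField c' b) z
      = (0, WithLp.toLp 2 fun h => db h - da h) := by
  unfold lieBracket
  rw [(hasFDerivAt_fibreField fun h => (ha h).1).fderiv,
    (hasFDerivAt_fibreField fun h => (hb h).1).fderiv]
  refine Prod.ext (by simp) ?_
  ext h
  simp [(ha h).2, (hb h).2]

variable {M : Type*} [TopologicalSpace M] [ChartedSpace (Rn n) M]
  [IsManifold 𝓘(ℝ, Rn n) ∞ M] {e : OpenPartialHomeomorph M (Rn n)}

/-- The pullback of a vector field on `ℝⁿ × ℝⁿ` to `T*M` by the induced chart. -/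
def chartField (e : OpenPartialHomeomorph M (Rn n)) (V : Rn n × Rn n → Rn n × Rn n)
    (ξ : CotangentBundle n M) : TangentSpace (cotModel n) ξ :=
  mpullback (cotModel n) 𝓘(ℝ, Rn n × Rn n) (inducedChart e) V ξ

theorem map_fibreField {V : Type*} [AddCommGroup V] [Module ℝ V] [TopologicalSpace V]
    (L : Rn n × Rn n →L[ℝ] V) (c : Rn n) (a : Fin n → Rn n × Rn n → ℝ) (z : Rn n × Rn n) :
    L (fibreField c a z) = ∑ i, c i • L (stdVec i, 0) + ∑ h, a h z • L (0, stdVec h) := by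
  have h1 : fibreField c a z = ∑ i, c i • ((stdVec i, 0) : Rn n × Rn n)
        + ∑ h, a h z • ((0, stdVec h) : Rn n × Rn n) := by
    have hs (w : Rn n) := sum_smul_stdVec w
    refine Prod.ext ?_ ?_
    · simp [fibreField, Prod.fst_sum, hs]
    · simp only [fibreField, Prod.snd_add, Prod.snd_sum, Prod.smul_snd, smul_zero,
        Finset.sum_const_zero, zero_add]
      exact (hs (WithLp.toLp 2 fun h => a h z)).symm
  rw [h1]
  simp only [map_add, map_sum, map_smul]

theorem chartField_fibreField (e : OpenPartialHomeomorph M (Rn n)) (c : Rn n)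
    (a : Fin n → Rn n × Rn n → ℝ) (ξ : CotangentBundle n M) :
    chartField e (fibreField c a) ξ
      = ∑ i, c i • dq e i ξ + ∑ h, a h (inducedChart e ξ) • dp e h ξ :=
  map_fibreField (mfderiv (cotModel n) 𝓘(ℝ, Rn n × Rn n) (inducedChart e) ξ).inverse c a
    (inducedChart e ξ)

theorem chartField_stdVec (e : OpenPartialHomeomorph M (Rn n)) (i : Fin n)
    (a : Fin n → Rn n × Rn n → ℝ) (ξ : CotangentBundle n M) :
    chartField e (fibreField (stdVec i) a) ξ
      = dq e i ξ + ∑ h, a h (inducedChart e ξ) • dp e h ξ := by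
  rw [chartField_fibreField]
  simp [stdVec]

theorem chartField_zero (e : OpenPartialHomeomorph M (Rn n))
    (a : Fin n → Rn n × Rn n → ℝ) (ξ : CotangentBundle n M) :
    chartField e (fibreField 0 a) ξ = ∑ h, a h (inducedChart e ξ) • dp e h ξ := by
  rw [chartField_fibreField]
  simp

theorem mdifferentiableAt_vectorSpace {E : Type*} [NormedAddCommGroup E] [NormedSpace ℝ E]
    {V : E → E} {z : E} (hV : DifferentiableAt ℝ V z) :
    MDifferentiableAt 𝓘(ℝ, E) 𝓘(ℝ, E).tangent (fun y => (⟨y, V y⟩ : TangentBundle 𝓘(ℝ, E) E)) z := by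
  refine (mdifferentiableAt_section _ _ ).2 ?_
  simpa using hV.mdifferentiableAt

theorem mdifferentiableAt_chartField (he : e ∈ IsManifold.maximalAtlas 𝓘(ℝ, Rn n) ∞ M)
    {ξ : CotangentBundle n M} (hξ : ξ.proj ∈ e.source) {V : Rn n × Rn n → Rn n × Rn n}
    (hV : DifferentiableAt ℝ V (inducedChart e ξ)) :
    MDifferentiableAt (cotModel n) (cotModel n).tangent
      (fun ζ => (chartField e V ζ : TangentBundle (cotModel n) (CotangentBundle n M))) ξ := by
  refine MDifferentiableAt.mpullback_vectorField (n := ∞) ?_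
    (contMDiffAt_inducedChart he hξ) (isInvertible_mfderiv_inducedChart he hξ) (by norm_cast)
  exact mdifferentiableAt_vectorSpace hV

theorem mlieBracket_chartField (he : e ∈ IsManifold.maximalAtlas 𝓘(ℝ, Rn n) ∞ M)
    {ξ : CotangentBundle n M} (hξ : ξ.proj ∈ e.source) {V W : Rn n × Rn n → Rn n × Rn n}
    (hV : DifferentiableAt ℝ V (inducedChart e ξ)) (hW : DifferentiableAt ℝ W (inducedChart e ξ)) :
    mlieBracket (cotModel n) (chartField e V) (chartField e W) ξ
      = chartField e (lieBracket ℝ V W) ξ := by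
  have : IsManifold (cotModel n) (minSmoothness ℝ 2) (CotangentBundle n M) := by
    rw [minSmoothness_of_isRCLikeNormedField]; infer_instance
  have h := mpullback_mlieBracket (I := cotModel n) (I' := 𝓘(ℝ, Rn n × Rn n)) (n := ∞)
    (f := inducedChart e) (x₀ := ξ) (V := V) (W := W)
    (mdifferentiableAt_vectorSpace hV)
    (mdifferentiableAt_vectorSpace hW)
    (contMDiffAt_inducedChart he hξ) (by simp; norm_cast)
  have h2 : mlieBracket 𝓘(ℝ, Rn n × Rn n) V W = lieBracket ℝ V W := by
    have h3 := mlieBracketWithin_eq_lieBracketWithin (𝕜 := ℝ) (V := V) (W := W) (s := univ)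
    rw [lieBracketWithin_univ] at h3
    exact h3
  exact h.symm.trans (congrArg (fun X => chartField e X ξ) h2)

theorem mlieBracket_chartField_fibreField (he : e ∈ IsManifold.maximalAtlas 𝓘(ℝ, Rn n) ∞ M)
    {ξ : CotangentBundle n M} (hξ : ξ.proj ∈ e.source)
    {c c' : Rn n} {a b : Fin n → Rn n × Rn n → ℝ} {da db : Fin n → ℝ}
    (ha : ∀ h, HasDirDeriv (a h) (inducedChart e ξ) (fibreField c' b (inducedChart e ξ)) (da h))
    (hb : ∀ h, HasDirDeriv (b h) (inducedChart e ξ) (fibreField c a (inducedChart e ξ)) (db h)) :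
    mlieBracket (cotModel n) (chartField e (fibreField c a)) (chartField e (fibreField c' b)) ξ
      = ∑ h, (db h - da h) • dp e h ξ := by
  rw [mlieBracket_chartField he hξ
    (hasFDerivAt_fibreField fun h => (ha h).1).differentiableAt
    (hasFDerivAt_fibreField fun h => (hb h).1).differentiableAt]
  refine Eq.trans ?_ (chartField_zero e (fun h _ => db h - da h) ξ)
  exact congrArg (mfderiv (cotModel n) 𝓘(ℝ, Rn n × Rn n) (inducedChart e) ξ).inverse
    (lieBracket_fibreField ha hb)

end Brackets

/-! ### Pointwise linear algebra in the adapted frame, and the Nijenhuis tensor on it. -/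

section AdaptedFrame

section LinearAlgebra

variable {ι κ V : Type*} [Fintype ι] [Fintype κ] [AddCommGroup V] [Module ℝ V]

theorem sum_smul_sum_smul (a : ι → ℝ) (b : ι → κ → ℝ) (x : κ → V) :
    ∑ j, a j • ∑ k, b j k • x k = ∑ k, (∑ j, a j * b j k) • x k := by
  simp only [Finset.smul_sum, Finset.sum_smul, mul_smul]
  exact Finset.sum_comm

theorem sum_smul_sum_smul_neg (β γ : ι → ℝ) (w : ι → ι → ι → ℝ) (y : ι → V) :
    ∑ l, γ l • ∑ r, β r • -∑ k, w l r k • y k = -∑ k, (∑ r, ∑ l, β r * γ l * w l r k) • y k := by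
  simp only [smul_neg, Finset.sum_neg_distrib, neg_inj, Finset.smul_sum, Finset.sum_smul,
    smul_smul]
  rw [Finset.sum_comm]
  conv_rhs => rw [Finset.sum_comm]
  refine Finset.sum_congr rfl fun r _ => ?_
  rw [Finset.sum_comm]
  exact Finset.sum_congr rfl fun l _ => Finset.sum_congr rfl fun k _ => by congr 1; ring

variable [TopologicalSpace V] {L : V →L[ℝ] V} {x y : ι → V} {a b : ι → ι → ℝ}

/-- Used with `x = δ/δq`, `y = ∂/∂p`, `w = ∂/∂q`: the relation `L² = -1` passes from `x` and `y` to
`w = x - ∑ c y`, hence to every combination. -/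
theorem sq_apply_of_span {w : ι → V} {c : ι → ι → ℝ} (hw : ∀ i, x i = w i + ∑ j, c i j • y j)
    (hx : ∀ i, L (L (x i)) = -x i) (hy : ∀ i, L (L (y i)) = -y i) (α β : ι → ℝ) :
    L (L (∑ i, α i • w i + ∑ i, β i • y i)) = -(∑ i, α i • w i + ∑ i, β i • y i) := by
  have hq (i : ι) : L (L (w i)) = -w i := by
    have h := hx i
    simp only [hw, map_add, map_sum, map_smul, hy, smul_neg, Finset.sum_neg_distrib,
      neg_add] at h
    exact add_right_cancel h
  simp only [map_add, map_sum, map_smul, hy, hq, smul_neg, Finset.sum_neg_distrib, neg_add]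

theorem sub_apply_sum_smul (L : V →L[ℝ] V) (y : ι → V) {a b c d w : ι → ℝ}
    (hbc : ∀ k, b k + c k = 0) (had : ∀ k, a k - d k = -w k) :
    ∑ k, a k • y k - L (∑ k, b k • y k) - L (∑ k, c k • y k) - ∑ k, d k • y k
      = -∑ k, w k • y k := by
  have h1 : L (∑ k, b k • y k) + L (∑ k, c k • y k) = 0 := by
    rw [← map_add, ← Finset.sum_add_distrib]
    simp only [← add_smul, hbc, zero_smul, Finset.sum_const_zero, map_zero]
  rw [sub_sub _ (L _) (L _), h1, sub_zero, ← Finset.sum_sub_distrib, ← Finset.sum_neg_distrib]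
  simp only [← sub_smul, had, neg_smul]

theorem sum_smul_neg_apply (hy : ∀ i, L (y i) = -∑ j, b i j • x j) (β : ι → ℝ) (w : ι → ι → ℝ) :
    ∑ r, β r • -L (-∑ l, w r l • y l) = -∑ k, (∑ l, ∑ r, b l k * β r * w r l) • x k := by
  simp only [map_neg, neg_neg, map_sum, map_smul, hy, smul_neg, Finset.sum_neg_distrib, neg_inj,
    Finset.smul_sum, Finset.sum_smul, smul_smul]
  rw [Finset.sum_congr rfl fun r _ => Finset.sum_comm, Finset.sum_comm]
  refine Finset.sum_congr rfl fun k _ => ?_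
  rw [Finset.sum_comm]
  exact Finset.sum_congr rfl fun l _ => Finset.sum_congr rfl fun r _ => by congr 1; ring

theorem neg_apply_neg_sum_smul (hL : ∀ v, L (L v) = -v) (β : ι → ℝ) (u : ι → V) :
    -L (-∑ r, β r • -L (u r)) = ∑ r, β r • u r := by
  simp only [map_neg, map_sum, map_smul, hL, neg_neg]

variable [DecidableEq ι]

theorem eq_sum_smul_apply_of_frame (hx : ∀ i, L (x i) = ∑ j, a i j • y j)
    (hba : ∀ i k, ∑ j, b i j * a j k = if i = k then 1 else 0) (i : ι) :
    y i = ∑ j, b i j • L (x j) := by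
  simp only [hx]
  rw [sum_smul_sum_smul]
  simp [hba]

theorem sq_apply_of_frame (hx : ∀ i, L (x i) = ∑ j, a i j • y j)
    (hy : ∀ i, L (y i) = -∑ j, b i j • x j)
    (hab : ∀ i k, ∑ j, a i j * b j k = if i = k then 1 else 0) (i : ι) :
    L (L (x i)) = -x i := by
  rw [hx]
  simp only [map_sum, map_smul, hy, smul_neg, Finset.sum_neg_distrib]
  rw [sum_smul_sum_smul]
  simp [hab]

theorem sq_apply_of_frame' (hx : ∀ i, L (x i) = ∑ j, a i j • y j)
    (hy : ∀ i, L (y i) = -∑ j, b i j • x j)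
    (hba : ∀ i k, ∑ j, b i j * a j k = if i = k then 1 else 0) (i : ι) :
    L (L (y i)) = -y i := by
  rw [hy]
  simp only [map_neg, map_sum, map_smul, hx]
  rw [sum_smul_sum_smul]
  simp [hba]

end LinearAlgebra

variable {n : ℕ} {M : Type*} [TopologicalSpace M] [ChartedSpace (Rn n) M]
  [IsManifold 𝓘(ℝ, Rn n) ∞ M] {g : Metric n M} {A : ℝ} {lam b₁ : ℝ → ℝ}
  {e : OpenPartialHomeomorph M (Rn n)}
  {J : ∀ ξ : CotangentBundle n M, TangentSpace (cotModel n) ξ →L[ℝ] TangentSpace (cotModel n) ξ}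

theorem eventually_proj_mem_source {ξ : CotangentBundle n M} (hξ : ξ.proj ∈ e.source) :
    ∀ᶠ ζ : CotangentBundle n M in nhds ξ, ζ.proj ∈ e.source :=
  (FiberBundle.continuous_proj _ _).continuousAt.preimage_mem_nhds (e.open_source.mem_nhds hξ)

theorem deltaq_eq_chartField (g : Metric n M) (e : OpenPartialHomeomorph M (Rn n)) (i : Fin n) :
    deltaq g e i = chartField e (fibreField (stdVec i) (horCoeff g e i)) := by
  funext ξ
  rw [chartField_stdVec]
  rfl

theorem IsNaturalDiagonalOn.apply_deltaq (hJ : IsNaturalDiagonalOn g A lam b₁ e J)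
    {ξ : CotangentBundle n M} (hξ : ξ.proj ∈ e.source) (i : Fin n) :
    J ξ (deltaq g e i ξ) = chartField e (fibreField 0 (J₁At g A lam b₁ e i)) ξ := by
  rw [(hJ ξ hξ i).1, chartField_zero]
  rfl

theorem IsNaturalDiagonalOn.eventuallyEq_deltaq (hJ : IsNaturalDiagonalOn g A lam b₁ e J)
    {ξ : CotangentBundle n M} (hξ : ξ.proj ∈ e.source) (i : Fin n) :
    (fun ζ => J ζ (deltaq g e i ζ))
      =ᶠ[nhds ξ] chartField e (fibreField 0 (J₁At g A lam b₁ e i)) :=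
  (eventually_proj_mem_source hξ).mono fun _ hζ => hJ.apply_deltaq hζ i

theorem IsNaturalDiagonalOn.sq_deltaq (hJ : IsNaturalDiagonalOn g A lam b₁ e J) (hA : 0 < A)
    (hlam_pos : ∀ t, 0 ≤ t → 0 < lam t) (hpos : ∀ t, 0 ≤ t → 0 < A + 2 * t * lam t * b₁ t)
    (he : e ∈ IsManifold.maximalAtlas 𝓘(ℝ, Rn n) ∞ M)
    {ξ : CotangentBundle n M} (hξ : ξ.proj ∈ e.source) (i : Fin n) :
    J ξ (J ξ (deltaq g e i ξ)) = -deltaq g e i ξ := by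
  have hz : (inducedChart e ξ).1 ∈ e.target := e.map_source hξ
  exact sq_apply_of_frame (fun i => (hJ ξ hξ i).1) (fun i => (hJ ξ hξ i).2)
    (sum_J₁At_mul_J₂At g hA hlam_pos hpos he hz) i

theorem IsNaturalDiagonalOn.sq_dp (hJ : IsNaturalDiagonalOn g A lam b₁ e J) (hA : 0 < A)
    (hlam_pos : ∀ t, 0 ≤ t → 0 < lam t) (hpos : ∀ t, 0 ≤ t → 0 < A + 2 * t * lam t * b₁ t)
    (he : e ∈ IsManifold.maximalAtlas 𝓘(ℝ, Rn n) ∞ M)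
    {ξ : CotangentBundle n M} (hξ : ξ.proj ∈ e.source) (i : Fin n) :
    J ξ (J ξ (dp e i ξ)) = -dp e i ξ := by
  have hz : (inducedChart e ξ).1 ∈ e.target := e.map_source hξ
  exact sq_apply_of_frame' (fun i => (hJ ξ hξ i).1) (fun i => (hJ ξ hξ i).2)
    (sum_J₂At_mul_J₁At g hA hlam_pos hpos he hz) i

/-- The fields `∂/∂qⁱ`, `∂/∂p_i` span the tangent spaces. -/
theorem eq_sum_dq_add_sum_dp (he : e ∈ IsManifold.maximalAtlas 𝓘(ℝ, Rn n) ∞ M)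
    {ξ : CotangentBundle n M} (hξ : ξ.proj ∈ e.source) (v : TangentSpace (cotModel n) ξ) :
    ∃ a b : Fin n → ℝ, v = ∑ i, a i • dq e i ξ + ∑ i, b i • dp e i ξ := by
  let w : Rn n × Rn n := mfderiv (cotModel n) 𝓘(ℝ, Rn n × Rn n) (inducedChart e) ξ v
  refine ⟨w.1, w.2, ?_⟩
  rw [← (isInvertible_mfderiv_inducedChart he hξ).inverse_apply_self v]
  exact map_fibreField (mfderiv (cotModel n) 𝓘(ℝ, Rn n × Rn n) (inducedChart e) ξ).inverse
    w.1 (fun h _ => w.2 h) 0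

theorem IsNaturalDiagonalOn.sq (hJ : IsNaturalDiagonalOn g A lam b₁ e J) (hA : 0 < A)
    (hlam_pos : ∀ t, 0 ≤ t → 0 < lam t) (hpos : ∀ t, 0 ≤ t → 0 < A + 2 * t * lam t * b₁ t)
    (he : e ∈ IsManifold.maximalAtlas 𝓘(ℝ, Rn n) ∞ M)
    {ξ : CotangentBundle n M} (hξ : ξ.proj ∈ e.source) (v : TangentSpace (cotModel n) ξ) :
    J ξ (J ξ v) = -v := by
  obtain ⟨a, b, rfl⟩ := eq_sum_dq_add_sum_dp he hξ v
  exact sq_apply_of_span (fun i => (rfl : deltaq g e i ξ = _))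
    (hJ.sq_deltaq hA hlam_pos hpos he hξ) (hJ.sq_dp hA hlam_pos hpos he hξ) a b

theorem IsNaturalDiagonalOn.nijenhuis_deltaq_deltaq (hJ : IsNaturalDiagonalOn g A lam b₁ e J)
    (hlam : DifferentiableOn ℝ lam (Ici 0)) (hb₁ : DifferentiableOn ℝ b₁ (Ici 0))
    (hlam_pos : ∀ t, 0 ≤ t → 0 < lam t)
    (he : e ∈ IsManifold.maximalAtlas 𝓘(ℝ, Rn n) ∞ M)
    {ξ : CotangentBundle n M} (hξ : ξ.proj ∈ e.source) (i j : Fin n) :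
    nijenhuis (cotModel n) J (deltaq g e i) (deltaq g e j) ξ
      = -∑ k, (∑ h, W g A lam b₁ e h k i j ξ * pCoord e h ξ) • dp e k ξ := by
  have hz : (inducedChart e ξ).1 ∈ e.target := e.map_source hξ
  have vv (i j k : Fin n) :=
    hasDirDeriv_J₁At_vertical g (A := A) hlam hb₁ hlam_pos he hz i j k
  have hv (i j k : Fin n) := hasDirDeriv_J₁At_horField g (A := A) hlam hb₁ hlam_pos he hz i j k
  have vh (i j k : Fin n) :=
    hasDirDeriv_horCoeff g he hz (fibreField 0 (J₁At g A lam b₁ e i) (inducedChart e ξ)) j k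
  have hh (i j k : Fin n) :=
    hasDirDeriv_horCoeff g he hz (fibreField (stdVec i) (horCoeff g e i) (inducedChart e ξ)) j k
  have r (i : Fin n) : deltaq g e i
      =ᶠ[nhds ξ] chartField e (fibreField (stdVec i) (horCoeff g e i)) :=
    Filter.EventuallyEq.of_eq (deltaq_eq_chartField g e i)
  have s := hJ.eventuallyEq_deltaq hξ
  unfold nijenhuis
  rw [(s i).mlieBracket_vectorField_eq (s j), (s i).mlieBracket_vectorField_eq (r j),
    (r i).mlieBracket_vectorField_eq (s j), (r i).mlieBracket_vectorField_eq (r j),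
    mlieBracket_chartField_fibreField he hξ (vv j i) (vv i j),
    mlieBracket_chartField_fibreField he hξ (hv j i) (vh i j),
    mlieBracket_chartField_fibreField he hξ (vh j i) (hv i j),
    mlieBracket_chartField_fibreField he hξ (hh j i) (hh i j)]
  refine sub_apply_sum_smul _ _ (fun k => ?_) (fun k => ?_)
  -- The mixed brackets reduce to `-Γ^l_ji J₁_lk` and `Γ^l_ij J₁_lk`, which cancel since the
  -- connection is torsion-free.
  · simp only [fibreField, map_zero, mul_zero, add_zero]
    rw [← Finset.sum_sub_distrib, ← Finset.sum_sub_distrib, ← Finset.sum_add_distrib]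
    exact Finset.sum_eq_zero fun l _ => by rw [christoffel_symm g e l j i]; ring
  · have hR := sum_curvature_mul g e (inducedChart e ξ) i j k
    have hW : ∑ h, W g A lam b₁ e h k i j ξ * pCoord e h ξ
        = A / lam (energyAt g e (inducedChart e ξ)) ^ 3 *
          (b₁ (energyAt g e (inducedChart e ξ)) * lam (energyAt g e (inducedChart e ξ)) *
            (lam (energyAt g e (inducedChart e ξ)) + 2 * energyAt g e (inducedChart e ξ) *
              derivHalfLine lam (energyAt g e (inducedChart e ξ)))
            + A * derivHalfLine lam (energyAt g e (inducedChart e ξ))) *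
          (gDown g e (inducedChart e ξ).1 j k * (inducedChart e ξ).2 i
            - gDown g e (inducedChart e ξ).1 i k * (inducedChart e ξ).2 j)
          + ∑ h, curvature g e h k i j (inducedChart e ξ).1 * (inducedChart e ξ).2 h := by
      change ∑ h, (_ * ((if h = i then 1 else 0) * gDown g e (inducedChart e ξ).1 j k
        - (if h = j then 1 else 0) * gDown g e (inducedChart e ξ).1 i k) + _)
          * (inducedChart e ξ).2 h = _
      simp only [add_mul, Finset.sum_add_distrib]
      simp only [mul_assoc, ← Finset.mul_sum, sub_mul, ite_mul, one_mul, zero_mul,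
        Finset.sum_sub_distrib, Finset.sum_ite_eq', Finset.mem_univ, if_true]
      rfl
    rw [hW, ← hR]
    have hl := (hlam_pos _ (energyAt_nonneg g e (inducedChart e ξ))).ne'
    simp only [fibreField, J₁At]
    -- With `g_ji = g_ij`, the terms in `b₁' p_i p_j p_k` and `b₁ J₁_ij p_k` are visibly symmetric
    -- in `i, j` and cancel on antisymmetrizing.
    rw [gDown_symm g e _ j i]
    generalize inducedChart e ξ = z at *
    field_simp
    ring

theorem IsNaturalDiagonalOn.nijenhuis_dp_right (hJ : IsNaturalDiagonalOn g A lam b₁ e J)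
    (hA : 0 < A) (hlam : DifferentiableOn ℝ lam (Ici 0)) (hb₁ : DifferentiableOn ℝ b₁ (Ici 0))
    (hlam_pos : ∀ t, 0 ≤ t → 0 < lam t) (hpos : ∀ t, 0 ≤ t → 0 < A + 2 * t * lam t * b₁ t)
    (he : e ∈ IsManifold.maximalAtlas 𝓘(ℝ, Rn n) ∞ M)
    {ξ : CotangentBundle n M} (hξ : ξ.proj ∈ e.source)
    (X : ∀ ζ : CotangentBundle n M, TangentSpace (cotModel n) ζ) (j : Fin n) :
    nijenhuis (cotModel n) J X (dp e j) ξ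
      = ∑ r, J₂ g A lam b₁ e j r ξ • -J ξ (nijenhuis (cotModel n) J X (deltaq g e r) ξ) := by
  have hsrc := eventually_proj_mem_source hξ
  have hz : (inducedChart e ξ).1 ∈ e.target := e.map_source hξ
  -- This holds over the chart domain only, hence an equality of germs, which suffices for brackets
  -- at `ξ`.
  have hdp : dp e j =ᶠ[nhds ξ]
      fun ζ => ∑ r, J₂ g A lam b₁ e j r ζ • J ζ (deltaq g e r ζ) := by
    filter_upwards [hsrc] with ζ hζ
    exact eq_sum_smul_apply_of_frame (y := fun i => dp e i ζ) (fun i => (hJ ζ hζ i).1)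
      (sum_J₂At_mul_J₁At g hA hlam_pos hpos he (e.map_source hζ)) j
  have hδ (r : Fin n) : MDifferentiableAt (cotModel n) (cotModel n).tangent
      (fun ζ => (deltaq g e r ζ : TangentBundle (cotModel n) (CotangentBundle n M))) ξ := by
    rw [deltaq_eq_chartField]
    exact mdifferentiableAt_chartField he hξ (hasFDerivAt_fibreField fun h =>
      (hasDirDeriv_horCoeff g he hz 0 r h).1).differentiableAt
  have hJδ (r : Fin n) : MDifferentiableAt (cotModel n) (cotModel n).tangent
      (fun ζ => (J ζ (deltaq g e r ζ) : TangentBundle (cotModel n) (CotangentBundle n M))) ξ := by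
    refine (mdifferentiableAt_chartField he hξ (hasFDerivAt_fibreField (c := 0) fun h =>
      (hasDirDeriv_J₁At_horField g (A := A) hlam hb₁ hlam_pos he hz r r h).1).differentiableAt
        ).congr_of_eventuallyEq (f₁ := fun ζ => (⟨ζ, J ζ (deltaq g e r ζ)⟩ :
          TangentBundle (cotModel n) (CotangentBundle n M))) ?_
    filter_upwards [hJ.eventuallyEq_deltaq hξ r] with ζ hζ
    rw [hζ]
  have hsqδ (r : Fin n) : ∀ᶠ ζ in nhds ξ, J ζ (J ζ (deltaq g e r ζ)) = -deltaq g e r ζ :=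
    hsrc.mono fun ζ hζ => hJ.sq_deltaq hA hlam_pos hpos he hζ r
  -- `J` is not assumed smooth; differentiability of `J J δ/δq^r` comes from its being `-δ/δq^r`
  -- near `ξ`.
  have hJJδ (r : Fin n) : MDifferentiableAt (cotModel n) (cotModel n).tangent
      (fun ζ => (J ζ (J ζ (deltaq g e r ζ)) :
        TangentBundle (cotModel n) (CotangentBundle n M))) ξ := by
    refine (mdifferentiableAt_neg_section (hδ r)).congr_of_eventuallyEq ?_
    filter_upwards [hsqδ r] with ζ hζ
    rw [hζ]
    rfl
  have hJ₂ (r : Fin n) : MDifferentiableAt (cotModel n) 𝓘(ℝ, ℝ) (J₂ g A lam b₁ e j r) ξ :=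
    (differentiableAt_J₂At g hA hlam hb₁ hpos he hz j r).mdifferentiableAt.comp ξ
      ((contMDiffAt_inducedChart he hξ).mdifferentiableAt (by simp))
  have hsq := hJ.sq hA hlam_pos hpos he hξ
  refine (nijenhuis_congr_right J X hdp).trans ((nijenhuis_sum_smul_right Finset.univ J X
    (fun r _ => hJ₂ r) (fun r _ => hJδ r) (fun r _ => hJJδ r) hsq).trans ?_)
  exact Finset.sum_congr rfl fun r _ => congrArg _
    (nijenhuis_apply_right J X _ (hδ r) (hsqδ r) hsq)

end AdaptedFrame

end CotangentGeometry

end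

theorem theorem3 {n : ℕ} {M : Type*} [TopologicalSpace M] [ChartedSpace (Rn n) M]
    [IsManifold 𝓘(ℝ, Rn n) ∞ M] (g : CotangentGeometry.Metric n M)
    (A : ℝ) (lam b₁ : ℝ → ℝ) (hA : 0 < A)
    (hlam : ContDiffOn ℝ ∞ lam (Ici 0)) (hb₁ : ContDiffOn ℝ ∞ b₁ (Ici 0))
    (hlam_pos : ∀ t, 0 ≤ t → 0 < lam t)
    (hpos : ∀ t, 0 ≤ t → 0 < A + 2 * t * lam t * b₁ t)
    (e : OpenPartialHomeomorph M (Rn n)) (he : e ∈ IsManifold.maximalAtlas 𝓘(ℝ, Rn n) ∞ M)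
    (J : ∀ ξ : CotangentBundle n M,
      TangentSpace (cotModel n) ξ →L[ℝ] TangentSpace (cotModel n) ξ)
    (hJ : IsNaturalDiagonalOn g A lam b₁ e J)
    (ξ : CotangentBundle n M) (hξ : ξ.proj ∈ e.source) (i j : Fin n) :
    nijenhuis (cotModel n) J (deltaq g e i) (deltaq g e j) ξ
        = -∑ k, (∑ h, W g A lam b₁ e h k i j ξ * pCoord e h ξ) • dp e k ξ ∧
    nijenhuis (cotModel n) J (deltaq g e i) (dp e j) ξ
        = -∑ k, (∑ l, ∑ r, ∑ h, J₂ g A lam b₁ e k l ξ * J₂ g A lam b₁ e j r ξ *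
            W g A lam b₁ e h l i r ξ * pCoord e h ξ) • deltaq g e k ξ ∧
    nijenhuis (cotModel n) J (dp e i) (dp e j) ξ
        = -∑ k, (∑ r, ∑ l, ∑ h, J₂ g A lam b₁ e i r ξ * J₂ g A lam b₁ e j l ξ *
            W g A lam b₁ e h k l r ξ * pCoord e h ξ) • dp e k ξ := by
  have hl : DifferentiableOn ℝ lam (Ici 0) := hlam.differentiableOn (by simp)
  have hb : DifferentiableOn ℝ b₁ (Ici 0) := hb₁.differentiableOn (by simp)
  have h1 := hJ.nijenhuis_deltaq_deltaq hl hb hlam_pos he hξ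
  have h2 := hJ.nijenhuis_dp_right hA hl hb hlam_pos hpos he hξ
  have hsq := hJ.sq hA hlam_pos hpos he hξ
  refine ⟨h1 i j, ?_, ?_⟩
  · rw [h2 (deltaq g e i) j]
    simp only [h1]
    rw [sum_smul_neg_apply (fun i => (hJ ξ hξ i).2)]
    congr 1
    refine Finset.sum_congr rfl fun k _ => ?_
    congr 1
    refine Finset.sum_congr rfl fun l _ => Finset.sum_congr rfl fun r _ => ?_
    rw [Finset.mul_sum]
    refine Finset.sum_congr rfl fun h _ => ?_
    -- Applying `J` to `∂/∂p_l` produces `J₂^{lk}`, whereas the claim has `J₂^{kl}`.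
    rw [show J₂ g A lam b₁ e k l ξ = J₂ g A lam b₁ e l k ξ from J₂At_symm g A lam b₁ e k l _]
    ring
  · rw [h2 (dp e i) j]
    -- Antisymmetry moves the remaining `∂/∂p_i` to the second slot, where the reduction applies
    -- again. This leaves `N(δ/δq^l, δ/δq^r)` with `r` contracted against `i` and `l` against `j`,
    -- hence the index order `l, r` in the result.
    simp only [nijenhuis_swap J (dp e i), h2]
    simp only [neg_apply_neg_sum_smul hsq]
    simp only [h1]
    rw [sum_smul_sum_smul_neg]
    congr 1
    refine Finset.sum_congr rfl fun k _ => ?_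
    congr 1
    refine Finset.sum_congr rfl fun r _ => Finset.sum_congr rfl fun l _ => ?_
    rw [Finset.mul_sum]
    exact Finset.sum_congr rfl fun h _ => by ring
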